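/- **Theorem.** Let $d \ge 1$, $0 < m < M$ and $\kappa := M/m$. Call $r : \mathbb{R}^k \to \mathbb{R}$ *radial* if $r(x) = h(\|x - c\|)$ for some $h : \mathbb{R} \to \mathbb{R}$ and $c \in \mathbb{R}^k$, and call $f : \mathbb{R}^d \to \mathbb{R}$ *radially-separable* if $f(x) = \sum_{i=1}^b r_i([Ux]_{S_i})$ for some orthogonal matrix $U \in \mathbb{R}^{d\times d}$, some partition $S_1, \dots, S_b$ of $\{1,\dots,d\}$ and some radial functions $r_1, \dots, r_b$, where $[Ux]_{S_i}$ is the subvector of the coordinates of $Ux$ in $S_i$. Let $\mathcal{F}$ be the class of functions $f : \mathbb{R}^d \to \mathbb{R}$ that are radially-separable, $m$-strongly convex and $M$-smooth (differentiable with $M$-Lipschitz gradient); $x^*$ denotes the minimizer of $f$. Let $\operatorname{Arcsine}(m,M)$ be the probability distribution on $\mathbb{R}$ with density $\beta \mapsto \mathbf{1}_{\beta \in (m,M)} / \big(\pi\sqrt{(M-\beta)(\beta-m)}\big)$. Let $\alpha_0, \alpha_1, \dots$ be random stepsizes whose inverses $\alpha_t^{-1}$ are i.i.d. real random variables with law $\mu$,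 and let $x_{t+1} = x_t - \alpha_t \nabla f(x_t)$ be the Gradient Descent iterates. 1. If $\mu = \operatorname{Arcsine}(m,M)$, then for every $f \in \mathcal{F}$ and every initialization $x_0 \neq x^*$, $$\left( \frac{\|x_n - x^*\|}{\|x_0 - x^*\|} \right)^{1/n} \longrightarrow \frac{\sqrt{\kappa}-1}{\sqrt{\kappa}+1} \qquad (n \to \infty)$$ both almost surely and in $L^1$. 2. This is the unique distribution for which Gradient Descent achieves this rate over the class: if $\mu$ is such that for every $f \in \mathcal{F}$, every $x_0 \neq x^*$ and every $\varepsilon > 0$, $$\mathbb{P}\left( \left( \frac{\|x_n - x^*\|}{\|x_0 - x^*\|} \right)^{1/n} \ge \frac{\sqrt{\kappa}-1}{\sqrt{\kappa}+1} + \varepsilon \right) \longrightarrow 0 \qquad (n \to \infty)$$ (in particular, if the convergence in 1 holds for all such $f$ and $x_0$ almost surely or in $L^1$), then $\mu = \operatorname{Arcsine}(m,M)$. -/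

import Mathlib

open MeasureTheory ProbabilityTheory Filter Topology
open scoped ENNReal

noncomputable section

/-- The Arcsine distribution on `(m, M)`: the measure on `ℝ` with density
`β ↦ 𝟙_{(m, M)}(β) / (π √((M - β) (β - m)))`. -/
def arcsineMeasure (m M : ℝ) : Measure ℝ :=
  volume.withDensity fun β =>
    ENNReal.ofReal ((Set.Ioo m M).indicator
      (fun β => 1 / (Real.pi * √((M - β) * (β - m)))) β)

/-- The Arcsine distribution is a probability measure. -/
theorem isProbabilityMeasure_arcsineMeasure {m M : ℝ} (h : m < M) :
    IsProbabilityMeasure (arcsineMeasure m M) := by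
  have hL : 0 < M - m := sub_pos.2 h
  set F : ℝ → ℝ := fun β => Real.arcsin ((2 * β - m - M) / (M - m)) / Real.pi with hF
  have hcont : ContinuousOn F (Set.Icc m M) := by
    have : Continuous F := by
      simp only [hF]
      exact (Real.continuous_arcsin.comp (by fun_prop)).div_const _
    exact this.continuousOn
  have hderiv : ∀ β ∈ Set.Ioo m M,
      HasDerivAt F (1 / (Real.pi * √((M - β) * (β - m)))) β := by
    intro β hβ
    have h1 : HasDerivAt (fun β : ℝ => (2 * β - m - M) / (M - m)) (2 / (M - m)) β := by
      have := ((((hasDerivAt_id β).const_mul 2).sub_const m).sub_const M).div_const (M - m)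
      simpa using this
    have hne1 : (2 * β - m - M) / (M - m) ≠ -1 := by
      rw [Ne, div_eq_iff hL.ne']; intro hh; linarith [hβ.1]
    have hne2 : (2 * β - m - M) / (M - m) ≠ 1 := by
      rw [Ne, div_eq_iff hL.ne']; intro hh; linarith [hβ.2]
    have h2 := ((Real.hasDerivAt_arcsin hne1 hne2).comp β h1).div_const Real.pi
    have hpos : 0 < (M - β) * (β - m) := mul_pos (sub_pos.2 hβ.2) (sub_pos.2 hβ.1)
    have hs : √(1 - ((2 * β - m - M) / (M - m)) ^ 2) =
        2 * √((M - β) * (β - m)) / (M - m) := by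
      rw [show 1 - ((2 * β - m - M) / (M - m)) ^ 2 =
          (2 / (M - m)) ^ 2 * ((M - β) * (β - m)) by field_simp; ring,
        Real.sqrt_mul (sq_nonneg _), Real.sqrt_sq (by positivity)]
      ring
    have hsp : 0 < √((M - β) * (β - m)) := Real.sqrt_pos.2 hpos
    refine h2.congr_deriv ?_
    rw [hs]
    have := Real.pi_pos
    field_simp
  have hnn : ∀ β ∈ Set.Ioo m M, 0 ≤ 1 / (Real.pi * √((M - β) * (β - m))) := fun β _ => by
    have := Real.pi_pos
    positivity
  have hint := intervalIntegral.integrableOn_deriv_of_nonneg hcont hderiv hnn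
  have hval : ∫ β in m..M, 1 / (Real.pi * √((M - β) * (β - m))) = 1 := by
    rw [intervalIntegral.integral_eq_sub_of_hasDerivAt_of_le h.le hcont hderiv
      ((intervalIntegrable_iff_integrableOn_Ioc_of_le h.le).2 hint)]
    simp only [hF]
    rw [show (2 * M - m - M) / (M - m) = 1 by field_simp; ring,
      show (2 * m - m - M) / (M - m) = -1 by field_simp; ring,
      Real.arcsin_one, Real.arcsin_neg_one]
    have := Real.pi_pos
    field_simp
    ring
  constructor
  rw [arcsineMeasure, withDensity_apply _ MeasurableSet.univ, setLIntegral_univ,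
    ← ofReal_integral_eq_lintegral_ofReal
      ((integrable_indicator_iff measurableSet_Ioo).2
        (hint.mono_set Set.Ioo_subset_Ioc_self))
      (Eventually.of_forall fun β => Set.indicator_nonneg hnn β),
    integral_indicator measurableSet_Ioo, ← integral_Ioc_eq_integral_Ioo,
    ← intervalIntegral.integral_of_le h.le, hval, ENNReal.ofReal_one]

/-- `r` is radial: `r x = h ‖x - c‖` for some function `h : ℝ → ℝ` and some center `c`. -/
def IsRadial {ι : Type*} [Fintype ι] (r : EuclideanSpace ℝ ι → ℝ) : Prop :=
  ∃ (h : ℝ → ℝ) (c : EuclideanSpace ℝ ι), ∀ x, r x = h ‖x - c‖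

/-- The subvector `[U x]_S` of the coordinates of `U x` in the set `S`. -/
def blockCoords {d : ℕ} (U : Matrix (Fin d) (Fin d) ℝ) (S : Finset (Fin d))
    (x : EuclideanSpace ℝ (Fin d)) : EuclideanSpace ℝ S :=
  WithLp.toLp 2 fun i : S => (U.mulVec x.ofLp) i

/-- `f` is radially-separable: `f x = ∑_S r_S ([U x]_S)`, where `U` is an orthogonal matrix,
`S` runs over the blocks of a partition of the coordinates, and each `r_S` is radial. -/
def IsRadiallySeparable {d : ℕ} (f : EuclideanSpace ℝ (Fin d) → ℝ) : Prop :=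
  ∃ U ∈ Matrix.orthogonalGroup (Fin d) ℝ,
  ∃ π : Finpartition (Finset.univ : Finset (Fin d)),
  ∃ r : (S : Finset (Fin d)) → EuclideanSpace ℝ S → ℝ,
    (∀ S ∈ π.parts, IsRadial (r S)) ∧
    ∀ x, f x = ∑ S ∈ π.parts, r S (blockCoords U S x)

/-- `f` is `M`-smooth: differentiable with `M`-Lipschitz gradient. -/
def IsSmoothWith {d : ℕ} (M : ℝ) (f : EuclideanSpace ℝ (Fin d) → ℝ) : Prop :=
  Differentiable ℝ f ∧ ∀ x y, ‖gradient f x - gradient f y‖ ≤ M * ‖x - y‖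

/-- The iterates of gradient descent on `f` with stepsizes `a 0, a 1, …`, started at `x₀`. -/
def gdIterate {d : ℕ} (f : EuclideanSpace ℝ (Fin d) → ℝ) (a : ℕ → ℝ)
    (x₀ : EuclideanSpace ℝ (Fin d)) : ℕ → EuclideanSpace ℝ (Fin d)
  | 0 => x₀
  | t + 1 => gdIterate f a x₀ t - a t • gradient f (gdIterate f a x₀ t)

/-- The average contraction factor `(‖xₙ - x*‖ / ‖x₀ - x*‖) ^ (1 / n)` of gradient descent. -/
def contractionFactor {d : ℕ} (f : EuclideanSpace ℝ (Fin d) → ℝ) (a : ℕ → ℝ)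
    (x₀ xstar : EuclideanSpace ℝ (Fin d)) (n : ℕ) : ℝ :=
  (‖gdIterate f a x₀ n - xstar‖ / ‖x₀ - xstar‖) ^ (1 / (n : ℝ))

/-- The accelerated rate `(√κ - 1) / (√κ + 1)`, where `κ = M / m`. -/
def acceleratedRate (m M : ℝ) : ℝ := (√(M / m) - 1) / (√(M / m) + 1)

/-- `f` is radially-separable, `m`-strongly convex and `M`-smooth; `xstar` is the minimizer
of `f`, and `x₀` is an initialization other than the minimizer. -/
structure IsInstance {d : ℕ} (m M : ℝ) (f : EuclideanSpace ℝ (Fin d) → ℝ)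
    (x₀ xstar : EuclideanSpace ℝ (Fin d)) : Prop where
  radiallySeparable : IsRadiallySeparable f
  stronglyConvex : StrongConvexOn Set.univ m f
  smooth : IsSmoothWith M f
  isMinimizer : ∀ x, f xstar ≤ f x
  init_ne : x₀ ≠ xstar

/-- The stepsizes `α 0, α 1, …` are random variables on `(Ω, P)` whose inverses `(α t)⁻¹` are
i.i.d. with law `μ`. (Inversion is a bijection of `ℝ`, with `0⁻¹ = 0`, so every i.i.d. sequence
of real stepsizes is of this form for exactly one `μ`.) -/
structure IsIIDInverseStepsizes {Ω : Type*} [MeasurableSpace Ω] (P : Measure Ω)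
    (α : ℕ → Ω → ℝ) (μ : Measure ℝ) : Prop where
  indep : iIndepFun (fun t ω => (α t ω)⁻¹) P
  law : ∀ t, HasLaw (fun ω => (α t ω)⁻¹) μ P

/-- The random variables `R n` converge to the constant `ρ` almost surely. -/
def ConvergesAlmostSurely {Ω : Type*} [MeasurableSpace Ω] (P : Measure Ω)
    (R : ℕ → Ω → ℝ) (ρ : ℝ) : Prop :=
  ∀ᵐ ω ∂P, Tendsto (fun n => R n ω) atTop (𝓝 ρ)

/-- The random variables `R n` are integrable and converge to the constant `ρ` in `L¹`. -/
def ConvergesInL1 {Ω : Type*} [MeasurableSpace Ω] (P : Measure Ω)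
    (R : ℕ → Ω → ℝ) (ρ : ℝ) : Prop :=
  (∀ n, MemLp (R n) 1 P) ∧ Tendsto (fun n => eLpNorm (fun ω => R n ω - ρ) 1 P) atTop (𝓝 0)

/-- The random variables `R n` are asymptotically at most `ρ` in probability: for each `ε > 0`,
the probability that `R n ≥ ρ + ε` tends to `0`. This is implied by convergence of `R n` to `ρ`
almost surely or in `L¹`, and by `limsup R n ≤ ρ` almost surely. -/
def AsymptoticallyAtMost {Ω : Type*} [MeasurableSpace Ω] (P : Measure Ω)
    (R : ℕ → Ω → ℝ) (ρ : ℝ) : Prop :=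
  ∀ ε > 0, Tendsto (fun n => P {ω | ρ + ε ≤ R n ω}) atTop (𝓝 0)

end

/-! Up to an isometry, a radially-separable `f` is a sum over blocks of functions of the squared
distance to one center, which is the minimizer. Symmetry makes the gradient in each block a scalar
multiple of the displacement, and strong convexity and smoothness put that scalar, the curvature, in
`[m, M]`. So with inverse stepsizes `β t`, gradient descent multiplies each block by `∏ (1 - l t / β
t)`, where `l t` depends only on `β 0, …, β (t - 1)`.

The Arcsine law is the equilibrium measure of `[m, M]`: its logarithmic potential is constant on the
interval and larger outside (Jensen's formula after `β = (m + M) / 2 + (M - m) / 2 * cos θ`). Hence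
`log |1 - l / β|` has the same mean, the log of the accelerated rate `ρ`, for every `l ∈ [m, M]`,
and it does not matter how `l t` depends on the past. Exponential moments uniform in `l` give a
Chernoff bound with summable tails, hence a law of large numbers in every block
(`ae_forall_eventually_abs_sum_logContraction_le`). The factors are at most `M / m`, so dominated
convergence gives `L¹`.

For the converse, quadratics suffice. The strong law turns the assumed rate into `E log |1 - l / β|
≤ log ρ` for `l ∈ [m, M]`, up to truncation and atoms of `μ`. Now average over `l`, with `1 / l`
Arcsine on `(1 / M, 1 / m)`: by the same potential theory the average is at least `log ρ` for every
fixed `β`, with equality only for `β ∈ [m, M]`. Tonelli forces equality throughout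
(`isEqualizing_of_forall_integral_le`): `μ` lives on `[m, M]`, and its expected log contraction is
`log ρ` at almost every `l ∈ (m, M)`. To see that this determines `μ`, average again with `1 / (l -
w)` Arcsine, for any `w < m`. This computes `∫ (log (b - w) - log b) ∂μ`
(`IsEqualizing.integral_log_sub`); derivatives in `w` at `0` give all moments of `1 / b`, which
determine its law since it is bounded. -/

/-! ### The Arcsine distribution and its logarithmic potential -/

/-- The Arcsine distribution is the law of `(a + b) / 2 + (b - a) / 2 * cos θ` for `θ` uniform
on `(0, π)`. -/
theorem arcsineMeasure_eq_map {a b : ℝ} (h : a < b) :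
    arcsineMeasure a b = (ENNReal.ofReal Real.pi⁻¹ • volume.restrict (Set.Ioo 0 Real.pi)).map
      (fun θ => (a + b) / 2 + (b - a) / 2 * Real.cos θ) := by
  set f : ℝ → ℝ := fun θ => (a + b) / 2 + (b - a) / 2 * Real.cos θ with hf
  have hfm : Measurable f := by fun_prop
  have hinj : Set.InjOn f (Set.Ioo 0 Real.pi) := by
    intro s hs t ht hst
    refine Real.injOn_cos (Set.Ioo_subset_Icc_self hs) (Set.Ioo_subset_Icc_self ht) ?_
    have h2 : (b - a) / 2 ≠ 0 := by linarith
    simpa [hf, h2, sub_eq_zero, h.ne'] using hst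
  have himg : f '' Set.Ioo 0 Real.pi = Set.Ioo a b := by
    ext x
    constructor
    · rintro ⟨θ, hθ, rfl⟩
      have hs := Real.sin_pos_of_pos_of_lt_pi hθ.1 hθ.2
      have hc := Real.sin_sq_add_cos_sq θ
      have h1 : Real.cos θ < 1 := by nlinarith
      have h2 : -1 < Real.cos θ := by nlinarith
      simp only [hf]
      constructor <;> nlinarith
    · intro hx
      have hR : 0 < b - a := by linarith
      refine ⟨Real.arccos ((2 * x - a - b) / (b - a)), ⟨?_, ?_⟩, ?_⟩
      · rw [Real.arccos_pos, div_lt_one hR]; linarith [hx.2]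
      · refine lt_of_le_of_ne (Real.arccos_le_pi _) fun hh => ?_
        rw [Real.arccos_eq_pi, div_le_iff₀ hR] at hh
        linarith [hx.1]
      · simp only [hf]
        rw [Real.cos_arccos]
        · field_simp; ring
        · rw [le_div_iff₀ hR]; linarith [hx.1]
        · rw [div_le_one hR]; linarith [hx.2]
  ext s hs
  rw [Measure.map_apply hfm hs, Measure.smul_apply, Measure.restrict_apply (hfm hs),
    arcsineMeasure, withDensity_apply _ hs, ← lintegral_indicator hs]
  have e1 : ∀ x, s.indicator (fun β => ENNReal.ofReal ((Set.Ioo a b).indicator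
      (fun β => 1 / (Real.pi * √((b - β) * (β - a)))) β)) x =
      (Set.Ioo a b).indicator (s.indicator fun β => ENNReal.ofReal
        (1 / (Real.pi * √((b - β) * (β - a))))) x := by
    intro x
    by_cases h1 : x ∈ s <;> by_cases h2 : x ∈ Set.Ioo a b <;> simp [h1, h2]
  simp_rw [e1]
  rw [lintegral_indicator measurableSet_Ioo, ← himg,
    lintegral_image_eq_lintegral_abs_deriv_mul (f' := fun θ => -((b - a) / 2 * Real.sin θ))
      measurableSet_Ioo _ hinj]
  -- The Jacobian `(b - a) / 2 * sin θ` equals `√((b - β) * (β - a))` at `β = f θ`, so only the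
  -- constant density `1 / π` is left.
  · have e2 : ∀ θ ∈ Set.Ioo 0 Real.pi, ENNReal.ofReal |-((b - a) / 2 * Real.sin θ)| *
        s.indicator (fun β => ENNReal.ofReal (1 / (Real.pi * √((b - β) * (β - a))))) (f θ) =
        (f ⁻¹' s).indicator (fun _ => ENNReal.ofReal Real.pi⁻¹) θ := by
      intro θ hθ
      have hsin := Real.sin_pos_of_pos_of_lt_pi hθ.1 hθ.2
      by_cases h1 : f θ ∈ s
      · rw [Set.indicator_of_mem h1, Set.indicator_of_mem (Set.mem_preimage.2 h1),
          ← ENNReal.ofReal_mul (abs_nonneg _)]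
        have hpos : 0 < (b - a) / 2 * Real.sin θ := by
          have : 0 < b - a := by linarith
          positivity
        have e3 : (b - f θ) * (f θ - a) = ((b - a) / 2 * Real.sin θ) ^ 2 := by
          simp only [hf]
          have := Real.sin_sq_add_cos_sq θ
          linear_combination (-((b - a) / 2) ^ 2) * this
        rw [e3, Real.sqrt_sq hpos.le, abs_neg, abs_of_pos hpos]
        congr 1
        have := Real.pi_pos
        have hne := hpos.ne'
        generalize (b - a) / 2 * Real.sin θ = c at hne
        field_simp
      · rw [Set.indicator_of_notMem h1, Set.indicator_of_notMem (by simpa using h1), mul_zero]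
    rw [setLIntegral_congr_fun measurableSet_Ioo e2, lintegral_indicator (hfm hs),
      lintegral_const, Measure.restrict_apply_univ, Measure.restrict_apply (hfm hs), smul_eq_mul]
  · intro θ _
    have := ((Real.hasDerivAt_cos θ).const_mul ((b - a) / 2)).const_add ((a + b) / 2)
    simp only [mul_neg] at this
    exact this.hasDerivWithinAt

theorem arcsineMeasure_ae_mem_Ioo (a b : ℝ) :
    ∀ᵐ x ∂arcsineMeasure a b, x ∈ Set.Ioo a b := by
  have hm : MeasurableSet (Set.Ioo a b)ᶜ := measurableSet_Ioo.compl
  change arcsineMeasure a b (Set.Ioo a b)ᶜ = 0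
  rw [arcsineMeasure, withDensity_apply _ hm, setLIntegral_congr_fun (g := 0) hm]
  · simp
  · intro x hx
    simp only [Pi.zero_apply]
    rw [Set.indicator_of_notMem hx, ENNReal.ofReal_zero]

theorem arcsineMeasure_absolutelyContinuous (a b : ℝ) : arcsineMeasure a b ≪ volume :=
  withDensity_absolutelyContinuous _ _

theorem integrable_arcsineMeasure_iff {a b : ℝ} (h : a < b) {g : ℝ → ℝ} (hg : Measurable g) :
    Integrable g (arcsineMeasure a b) ↔
      IntervalIntegrable (fun θ => g ((a + b) / 2 + (b - a) / 2 * Real.cos θ))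
        volume 0 Real.pi := by
  rw [arcsineMeasure_eq_map h, integrable_map_measure hg.aestronglyMeasurable (by fun_prop),
    integrable_smul_measure (by simp [Real.pi_pos]) (by simp),
    intervalIntegrable_iff_integrableOn_Ioo_of_le Real.pi_pos.le]
  rfl

theorem integral_arcsineMeasure {a b : ℝ} (h : a < b) {g : ℝ → ℝ} (hg : Measurable g) :
    ∫ x, g x ∂arcsineMeasure a b =
      Real.pi⁻¹ * ∫ θ in (0)..Real.pi, g ((a + b) / 2 + (b - a) / 2 * Real.cos θ) := by
  rw [arcsineMeasure_eq_map h, integral_map (by fun_prop) hg.aestronglyMeasurable,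
    integral_smul_measure, intervalIntegral.integral_of_le Real.pi_pos.le,
    integral_Ioc_eq_integral_Ioo, ENNReal.toReal_ofReal (by positivity), smul_eq_mul]

/-- Makes negligible the angles at which a logarithm takes the default value `Real.log 0 = 0`. -/
theorem countable_cos_eq (y : ℝ) : {θ : ℝ | Real.cos θ = y}.Countable := by
  rcases Set.eq_empty_or_nonempty {θ : ℝ | Real.cos θ = y} with h | ⟨θ₀, h⟩
  · simp [h]
  · refine ((Set.countable_range fun k : ℤ => 2 * k * Real.pi + θ₀).union
      (Set.countable_range fun k : ℤ => 2 * k * Real.pi - θ₀)).mono ?_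
    intro θ hθ
    have : Real.cos θ₀ = Real.cos θ := by rw [Set.mem_ofPred_eq] at h hθ; rw [h, hθ]
    obtain ⟨k, hk | hk⟩ := Real.cos_eq_cos_iff.1 this
    · exact Or.inl ⟨k, hk.symm⟩
    · exact Or.inr ⟨k, hk.symm⟩

/-- Joukowski substitution: for `z = exp (iθ)`, `(z - p) (z - p⁻¹) = z (z + z⁻¹ - p - p⁻¹) = 2 z
(cos θ - y)`. -/
theorem norm_circleMap_sub_mul {p : ℂ} (hp : p ≠ 0) {y : ℝ} (hy : p + p⁻¹ = 2 * y) (θ : ℝ) :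
    ‖circleMap 0 1 θ - p‖ * ‖circleMap 0 1 θ - p⁻¹‖ = 2 * |Real.cos θ - y| := by
  have h1 : circleMap 0 1 θ = Complex.exp (θ * Complex.I) := by simp [circleMap]
  set z := circleMap 0 1 θ with hz
  have hz0 : z ≠ 0 := by rw [h1]; exact Complex.exp_ne_zero _
  have hn : ‖z‖ = 1 := by rw [h1]; exact Complex.norm_exp_ofReal_mul_I θ
  have hzi : z⁻¹ = Complex.exp (-θ * Complex.I) := by
    rw [h1, ← Complex.exp_neg, neg_mul]
  have h2 : z + z⁻¹ = 2 * (Real.cos θ : ℂ) := by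
    rw [hzi, h1, Complex.ofReal_cos, Complex.cos]; ring
  have h3 : (z - p) * (z - p⁻¹) = z * (2 * ((Real.cos θ - y : ℝ) : ℂ)) := by
    push_cast
    rw [Complex.ofReal_cos] at h2
    have h4 : 2 * (Complex.cos θ - y) = z + z⁻¹ - (p + p⁻¹) := by rw [hy, h2, mul_sub]
    rw [h4]
    field_simp
    ring
  rw [← norm_mul, h3, norm_mul, hn, one_mul, norm_mul, Complex.norm_real, Real.norm_eq_abs]
  simp

/-- By Jensen's formula, `log |z - p|` and `log |z - p⁻¹|` have circle averages `log⁺ |p|` and `log⁺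
|p⁻¹|`, which add up to `|log |p||`. The reflection `θ ↦ 2π - θ` reduces the circle to a half
circle. -/
theorem integral_log_cos_sub {p : ℂ} (hp : p ≠ 0) {y : ℝ} (hy : p + p⁻¹ = 2 * y) :
    IntervalIntegrable (fun θ => Real.log |Real.cos θ - y|) volume 0 Real.pi ∧
      ∫ θ in (0)..Real.pi, Real.log |Real.cos θ - y| =
        Real.pi * (|Real.log ‖p‖| - Real.log 2) := by
  have hpi := Real.pi_pos
  set G : ℝ → ℝ := fun θ => Real.log |Real.cos θ - y|
  have i1 : IntervalIntegrable (fun θ => Real.log ‖circleMap 0 1 θ - p‖) volume 0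
    (2 * Real.pi) := circleIntegrable_log_norm_sub_const (a := p) (c := 0) 1
  have i2 : IntervalIntegrable (fun θ => Real.log ‖circleMap 0 1 θ - p⁻¹‖) volume 0
    (2 * Real.pi) := circleIntegrable_log_norm_sub_const (a := p⁻¹) (c := 0) 1
  have hae : (fun θ => Real.log ‖circleMap 0 1 θ - p‖ + Real.log ‖circleMap 0 1 θ - p⁻¹‖ -
      Real.log 2) =ᵐ[volume] G := by
    filter_upwards [(countable_cos_eq y).ae_notMem volume] with θ hθ
    have h0 : Real.cos θ - y ≠ 0 := sub_ne_zero.2 hθ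
    have h1 := norm_circleMap_sub_mul hp hy θ
    have h2 : ‖circleMap 0 1 θ - p‖ ≠ 0 := fun hh => by
      rw [hh, zero_mul] at h1; simp [h0] at h1
    have h3 : ‖circleMap 0 1 θ - p⁻¹‖ ≠ 0 := fun hh => by
      rw [hh, mul_zero] at h1; simp [h0] at h1
    rw [← Real.log_mul h2 h3, h1, Real.log_mul two_ne_zero (abs_ne_zero.2 h0)]
    simp [G]
  have hG : IntervalIntegrable G volume 0 (2 * Real.pi) :=
    ((i1.add i2).sub intervalIntegrable_const).congr_ae (ae_restrict_of_ae hae)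
  have hG1 : IntervalIntegrable G volume 0 Real.pi := hG.mono_set (by
    rw [Set.uIcc_of_le hpi.le, Set.uIcc_of_le (by linarith)]
    exact Set.Icc_subset_Icc_right (by linarith))
  have hG2 : IntervalIntegrable G volume Real.pi (2 * Real.pi) := hG.mono_set (by
    rw [Set.uIcc_of_le (by linarith), Set.uIcc_of_le (by linarith)]
    exact Set.Icc_subset_Icc_left (by linarith))
  refine ⟨hG1, ?_⟩
  have hsym : ∫ θ in Real.pi..(2 * Real.pi), G θ = ∫ θ in (0)..Real.pi, G θ := by
    have := intervalIntegral.integral_comp_sub_left (a := 0) (b := Real.pi) G (2 * Real.pi)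
    rw [show 2 * Real.pi - Real.pi = Real.pi by ring, sub_zero] at this
    rw [← this]
    simp [G]
  have htot : ∫ θ in (0)..(2 * Real.pi), G θ =
      2 * Real.pi * (|Real.log ‖p‖| - Real.log 2) := by
    rw [← intervalIntegral.integral_congr_ae (Filter.Eventually.mono hae fun θ h _ => h),
      intervalIntegral.integral_sub (i1.add i2) intervalIntegrable_const,
      intervalIntegral.integral_add i1 i2]
    have c1 := circleAverage_log_norm_sub_const_eq_posLog (a := p)
    have c2 := circleAverage_log_norm_sub_const_eq_posLog (a := p⁻¹)
    rw [Real.circleAverage_def, smul_eq_mul, inv_mul_eq_iff_eq_mul₀ (by positivity)] at c1 c2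
    rw [c1, c2, Real.posLog_apply, Real.posLog_apply, norm_inv, Real.log_inv]
    simp only [intervalIntegral.integral_const, smul_eq_mul]
    have : max 0 (Real.log ‖p‖) + max 0 (-Real.log ‖p‖) = |Real.log ‖p‖| := by
      rcases le_total 0 (Real.log ‖p‖) with h | h
      · rw [max_eq_right h, max_eq_left (by linarith), abs_of_nonneg h, add_zero]
      · rw [max_eq_left h, max_eq_right (by linarith), abs_of_nonpos h, zero_add]
    rw [← this]; ring
  have := intervalIntegral.integral_add_adjacent_intervals hG1 hG2
  rw [hsym, htot] at this
  linarith

/-- In the variable `θ`, `u - x` is `(b - a) / 2 * (cos θ - y)` with `y` the affine image of `x`;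
the term `-log 2` of the cosine integral turns `(b - a) / 2` into `(b - a) / 4`. -/
theorem arcsineMeasure_log_aux {a b x : ℝ} (h : a < b) {p : ℂ} (hp : p ≠ 0)
    (hy : p + p⁻¹ = 2 * (((2 * x - a - b) / (b - a) : ℝ) : ℂ)) :
    Integrable (fun u => Real.log |u - x|) (arcsineMeasure a b) ∧
      ∫ u, Real.log |u - x| ∂arcsineMeasure a b =
        Real.log ((b - a) / 4) + |Real.log ‖p‖| := by
  have hR : 0 < b - a := by linarith
  have hpi := Real.pi_pos
  obtain ⟨i1, e1⟩ := integral_log_cos_sub hp hy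
  have hm : Measurable fun u : ℝ => Real.log |u - x| := by fun_prop
  have hae : (fun θ => Real.log ((b - a) / 2) +
      Real.log |Real.cos θ - (2 * x - a - b) / (b - a)|) =ᵐ[volume]
      fun θ => Real.log |(a + b) / 2 + (b - a) / 2 * Real.cos θ - x| := by
    filter_upwards [(countable_cos_eq ((2 * x - a - b) / (b - a))).ae_notMem volume] with θ hθ
    have h0 : Real.cos θ - (2 * x - a - b) / (b - a) ≠ 0 := sub_ne_zero.2 hθ
    rw [← Real.log_mul (by positivity) (abs_ne_zero.2 h0), ← abs_of_pos (half_pos hR), ← abs_mul,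
      abs_of_pos (half_pos hR)]
    congr 2
    field_simp
    ring
  rw [integrable_arcsineMeasure_iff h hm, integral_arcsineMeasure h hm]
  refine ⟨(intervalIntegrable_const.add i1).congr_ae (ae_restrict_of_ae hae), ?_⟩
  rw [← intervalIntegral.integral_congr_ae (Filter.Eventually.mono hae fun θ h _ => h),
    intervalIntegral.integral_add intervalIntegrable_const i1, e1,
    show (b - a) / 4 = ((b - a) / 2) / 2 by ring, Real.log_div (half_pos hR).ne' two_ne_zero]
  simp only [intervalIntegral.integral_const, smul_eq_mul, sub_zero]
  rw [mul_add, inv_mul_cancel_left₀ hpi.ne', inv_mul_cancel_left₀ hpi.ne']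
  ring

/-- Here `y = cos φ`, so `p = exp (iφ)` is unimodular and the term `|log ‖p‖|` vanishes: the
potential is constant on the interval. -/
theorem arcsineMeasure_log_of_mem {a b x : ℝ} (h : a < b) (hx : x ∈ Set.Icc a b) :
    Integrable (fun u => Real.log |u - x|) (arcsineMeasure a b) ∧
      ∫ u, Real.log |u - x| ∂arcsineMeasure a b = Real.log ((b - a) / 4) := by
  have hR : 0 < b - a := by linarith
  set y := (2 * x - a - b) / (b - a) with hy
  have h1 : y ∈ Set.Icc (-1) 1 := by
    rw [hy]
    constructor
    · rw [le_div_iff₀ hR]; linarith [hx.1]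
    · rw [div_le_one hR]; linarith [hx.2]
  have hc : Real.cos (Real.arccos y) = y := Real.cos_arccos h1.1 h1.2
  have hn : ‖Complex.exp (Real.arccos y * Complex.I)‖ = 1 := Complex.norm_exp_ofReal_mul_I _
  have := arcsineMeasure_log_aux (x := x) h (Complex.exp_ne_zero (Real.arccos y * Complex.I)) (by
    rw [← hy]
    conv_rhs => rw [← hc]
    rw [← Complex.exp_neg, Complex.ofReal_cos, Complex.cos, neg_mul]
    ring)
  rwa [hn, Real.log_one, abs_zero, add_zero] at this

theorem arcsineMeasure_log_of_lt {a b x : ℝ} (h : a < b) (hx : x < a) :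
    Integrable (fun u => Real.log |u - x|) (arcsineMeasure a b) ∧
      ∫ u, Real.log |u - x| ∂arcsineMeasure a b =
        Real.log ((√(a - x) + √(b - x)) ^ 2 / 4) ∧
      Real.log ((b - a) / 4) < Real.log ((√(a - x) + √(b - x)) ^ 2 / 4) := by
  have hR : 0 < b - a := by linarith
  have hA : 0 < √(a - x) := Real.sqrt_pos.2 (by linarith)
  have hB : 0 < √(b - x) := Real.sqrt_pos.2 (by linarith)
  have hA2 : √(a - x) ^ 2 = a - x := Real.sq_sqrt (by linarith)
  have hB2 : √(b - x) ^ 2 = b - x := Real.sq_sqrt (by linarith)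
  set A := √(a - x)
  set B := √(b - x)
  have hAB : A < B := by nlinarith
  have hlt : (b - a) / 4 < (A + B) ^ 2 / 4 := by nlinarith
  have hR' : b - a = (B - A) * (B + A) := by linarith
  have hq : 1 < (A + B) / (B - A) := by rw [one_lt_div] <;> linarith
  -- The root of `p + p⁻¹ = 2y` of modulus greater than `1`. Since `b - a = (B - A) * (B + A)`, the
  -- product `(b - a) / 4 * |p|` is `(A + B) ^ 2 / 4`.
  have hne : ((-((A + B) / (B - A)) : ℝ) : ℂ) ≠ 0 := by
    rw [Complex.ofReal_ne_zero]; linarith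
  obtain ⟨i1, e1⟩ := arcsineMeasure_log_aux (x := x) h hne (by
    rw [← Complex.ofReal_inv, ← Complex.ofReal_add, ← Complex.ofReal_ofNat, ← Complex.ofReal_mul,
      Complex.ofReal_inj]
    have h1 : B - A ≠ 0 := by linarith
    have h2 : A + B ≠ 0 := by linarith
    have h3 : B + A ≠ 0 := by linarith
    rw [hR', show 2 * x - a - b = -(A ^ 2 + B ^ 2) by linarith]
    field_simp
    ring)
  refine ⟨i1, ?_, Real.log_lt_log (by linarith) hlt⟩
  rw [e1, Complex.norm_real, Real.norm_eq_abs, abs_neg, abs_of_pos (zero_lt_one.trans hq),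
    abs_of_pos (Real.log_pos hq), ← Real.log_mul (by positivity) (by linarith)]
  congr 1
  have h1 : B - A ≠ 0 := by linarith
  rw [hR']
  field_simp
  ring

theorem arcsineMeasure_log_of_gt {a b x : ℝ} (h : a < b) (hx : b < x) :
    Integrable (fun u => Real.log |u - x|) (arcsineMeasure a b) ∧
      Real.log ((b - a) / 4) < ∫ u, Real.log |u - x| ∂arcsineMeasure a b := by
  have hR : 0 < b - a := by linarith
  set y := (2 * x - a - b) / (b - a) with hy
  have h1 : 1 < y := by rw [hy, one_lt_div hR]; linarith
  have hs : √(y ^ 2 - 1) ^ 2 = y ^ 2 - 1 := Real.sq_sqrt (by nlinarith)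
  have hs0 : 0 ≤ √(y ^ 2 - 1) := Real.sqrt_nonneg _
  set s := √(y ^ 2 - 1)
  -- Again the root of `p + p⁻¹ = 2y` outside the unit circle; only `|p| > 1` matters here.
  have hne : ((y + s : ℝ) : ℂ) ≠ 0 := by rw [Complex.ofReal_ne_zero]; linarith
  obtain ⟨i1, e1⟩ := arcsineMeasure_log_aux (x := x) h hne (by
    rw [← hy, ← Complex.ofReal_inv, ← Complex.ofReal_add, ← Complex.ofReal_ofNat,
      ← Complex.ofReal_mul, Complex.ofReal_inj]
    have : y + s ≠ 0 := by linarith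
    field_simp
    linarith)
  refine ⟨i1, ?_⟩
  rw [e1, Complex.norm_real, Real.norm_eq_abs, abs_of_pos (by linarith : (0 : ℝ) < y + s)]
  have := Real.log_pos (show 1 < y + s by linarith)
  rw [abs_of_pos this]
  linarith

theorem integrable_log_abs_sub_arcsineMeasure {a b : ℝ} (h : a < b) (x : ℝ) :
    Integrable (fun u => Real.log |u - x|) (arcsineMeasure a b) := by
  by_cases h1 : x < a
  · exact (arcsineMeasure_log_of_lt h h1).1
  by_cases h2 : b < x
  · exact (arcsineMeasure_log_of_gt h h2).1
  exact (arcsineMeasure_log_of_mem h ⟨not_lt.1 h1, not_lt.1 h2⟩).1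

theorem log_le_integral_log_arcsineMeasure {a b : ℝ} (h : a < b) (x : ℝ) :
    Real.log ((b - a) / 4) ≤ ∫ u, Real.log |u - x| ∂arcsineMeasure a b := by
  by_cases h1 : x < a
  · rw [(arcsineMeasure_log_of_lt h h1).2.1]; exact (arcsineMeasure_log_of_lt h h1).2.2.le
  by_cases h2 : b < x
  · exact (arcsineMeasure_log_of_gt h h2).2.le
  exact (arcsineMeasure_log_of_mem h ⟨not_lt.1 h1, not_lt.1 h2⟩).2.ge

theorem mem_Icc_of_integral_log_arcsineMeasure_le {a b : ℝ} (h : a < b) {x : ℝ}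
    (hx : ∫ u, Real.log |u - x| ∂arcsineMeasure a b ≤ Real.log ((b - a) / 4)) :
    x ∈ Set.Icc a b := by
  constructor
  · by_contra! h1
    obtain ⟨-, e, hlt⟩ := arcsineMeasure_log_of_lt h h1
    rw [e] at hx
    exact absurd hx (not_le.2 hlt)
  · by_contra! h1
    exact absurd hx (not_le.2 (arcsineMeasure_log_of_gt h h1).2)

theorem integral_log_arcsineMeasure {a b : ℝ} (ha : 0 < a) (h : a < b) :
    Integrable (fun u => Real.log u) (arcsineMeasure a b) ∧
      ∫ u, Real.log u ∂arcsineMeasure a b = Real.log ((√a + √b) ^ 2 / 4) := by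
  obtain ⟨i, e, -⟩ := arcsineMeasure_log_of_lt h ha
  simp only [sub_zero, Real.log_abs] at i e
  exact ⟨i, e⟩

/-! ### The accelerated rate as a difference of potentials -/

theorem acceleratedRate_pos {m M : ℝ} (hm : 0 < m) (hmM : m < M) : 0 < acceleratedRate m M := by
  have h1 : 1 < √(M / m) := by
    rw [Real.lt_sqrt zero_le_one]; rw [one_pow, one_lt_div hm]; exact hmM
  exact div_pos (by linarith) (by linarith)

theorem acceleratedRate_lt_one {m M : ℝ} : acceleratedRate m M < 1 := by
  have h1 : 0 ≤ √(M / m) := Real.sqrt_nonneg _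
  rw [acceleratedRate, div_lt_one (by linarith)]
  linarith

/-- The numerator is the exponential of the potential on `[m, M]`, the denominator that of the
potential at `0`. Their quotient is what `log |1 - l / β| = log |β - l| - log β` produces on
average. -/
theorem acceleratedRate_eq {m M : ℝ} (hm : 0 < m) (hmM : m < M) :
    acceleratedRate m M = ((M - m) / 4) / ((√m + √M) ^ 2 / 4) := by
  have h0 : 0 < √m := Real.sqrt_pos.2 hm
  have h1 : √m ^ 2 = m := Real.sq_sqrt hm.le
  have h2 : √M ^ 2 = M := Real.sq_sqrt (by linarith)
  have h3 : 0 < √M := Real.sqrt_pos.2 (by linarith)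
  rw [acceleratedRate, Real.sqrt_div (by linarith)]
  conv_rhs => rw [← h1, ← h2]
  rw [Real.sqrt_sq h3.le, Real.sqrt_sq h0.le]
  have : √m + √M ≠ 0 := by positivity
  have : √M + √m ≠ 0 := by positivity
  field_simp
  ring

theorem log_acceleratedRate {m M : ℝ} (hm : 0 < m) (hmM : m < M) :
    Real.log (acceleratedRate m M) =
      Real.log ((M - m) / 4) - Real.log ((√m + √M) ^ 2 / 4) := by
  have h0 : 0 < √m := Real.sqrt_pos.2 hm
  rw [acceleratedRate_eq hm hmM, Real.log_div] <;> nlinarith [Real.sqrt_nonneg M]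

/-- Every quadratic with curvature in `[m, M]` has the same expected log contraction under
Arcsine inverse stepsizes. -/
theorem integral_log_one_sub_div_arcsineMeasure {m M l : ℝ} (hm : 0 < m) (hmM : m < M)
    (hl : l ∈ Set.Icc m M) :
    Integrable (fun β => Real.log |1 - l / β|) (arcsineMeasure m M) ∧
      ∫ β, Real.log |1 - l / β| ∂arcsineMeasure m M = Real.log (acceleratedRate m M) := by
  obtain ⟨i1, e1⟩ := arcsineMeasure_log_of_mem hmM hl
  obtain ⟨i2, e2⟩ := integral_log_arcsineMeasure hm hmM
  have hae : (fun β => Real.log |β - l| - Real.log β) =ᵐ[arcsineMeasure m M]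
      fun β => Real.log |1 - l / β| := by
    filter_upwards [arcsineMeasure_ae_mem_Ioo m M,
      (arcsineMeasure_absolutelyContinuous m M).ae_le (Measure.ae_ne volume l)] with β hβ hne
    have hβ0 : 0 < β := hm.trans hβ.1
    rw [one_sub_div hβ0.ne', abs_div, Real.log_div (abs_ne_zero.2 (sub_ne_zero.2 hne))
      (abs_ne_zero.2 hβ0.ne'), Real.log_abs β]
  refine ⟨(i1.sub i2).congr hae, ?_⟩
  rw [← integral_congr_ae hae, integral_sub i1 i2, e1, e2, log_acceleratedRate hm hmM]

/-! ### Uniform exponential moments and Chernoff bounds -/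

theorem lintegral_abs_rpow_neg_lt_top {r : ℝ} (hr : -1 < r) {L : ℝ} (hL : 0 < L) :
    ∫⁻ t in Set.Ioo (-L) L, ENNReal.ofReal (|t| ^ r) < ⊤ := by
  have h1 : IntervalIntegrable (fun t : ℝ => |t| ^ r) volume 0 L := by
    refine (intervalIntegral.intervalIntegrable_rpow' (a := 0) (b := L) hr).congr fun t ht => ?_
    rw [Set.uIoc_of_le hL.le] at ht
    simp only [abs_of_pos ht.1]
  have h2 : IntervalIntegrable (fun t : ℝ => |t| ^ r) volume (-L) 0 := by
    rw [IntervalIntegrable.iff_comp_neg]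
    simpa using h1.symm
  have h3 := (intervalIntegrable_iff_integrableOn_Ioo_of_le (by linarith)).1 (h2.trans h1)
  exact h3.lintegral_lt_top

theorem lintegral_abs_sub_rpow_neg_le {r a b x : ℝ} (hx : x ∈ Set.Icc a b) :
    ∫⁻ t in Set.Ioo a b, ENNReal.ofReal (|t - x| ^ r) ≤
      ∫⁻ t in Set.Ioo (-(b - a)) (b - a), ENNReal.ofReal (|t| ^ r) := by
  rw [← lintegral_indicator measurableSet_Ioo, ← lintegral_indicator measurableSet_Ioo,
    ← lintegral_sub_right_eq_self (fun t => (Set.Ioo (-(b - a)) (b - a)).indicator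
      (fun t => ENNReal.ofReal (|t| ^ r)) t) x]
  refine lintegral_mono fun t => ?_
  by_cases ht : t ∈ Set.Ioo a b
  · rw [Set.indicator_of_mem ht, Set.indicator_of_mem]
    exact ⟨by linarith [ht.1, hx.2], by linarith [ht.2, hx.1]⟩
  · simp [Set.indicator_of_notMem ht]

theorem sq_mul_le_cube_add_cube {p r : ℝ} (hp : 0 ≤ p) (hr : 0 ≤ r) :
    p ^ 2 * r ≤ p ^ 3 + r ^ 3 := by
  rcases le_total p r with h | h
  · nlinarith [mul_nonneg hr hr, pow_nonneg hp 3, mul_le_mul h h hp hr]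
  · nlinarith [mul_nonneg hp hp, pow_nonneg hr 3]

/-- At least one of `b - t` and `t - a` is at least half the length of the interval, so the endpoint
singularities can be separated. -/
theorem one_div_sqrt_mul_le {a b t : ℝ} (ht : t ∈ Set.Ioo a b) :
    1 / √((b - t) * (t - a)) ≤
      ((b - a) / 2) ^ (-(1 / 2) : ℝ) *
        (|t - a| ^ (-(1 / 2) : ℝ) + |t - b| ^ (-(1 / 2) : ℝ)) := by
  have h1 : 0 < b - t := by linarith [ht.2]
  have h2 : 0 < t - a := by linarith [ht.1]
  have h3 : 0 < (b - a) / 2 := by linarith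
  rw [abs_of_pos h2, abs_sub_comm, abs_of_pos h1, Real.sqrt_eq_rpow, one_div,
    ← Real.rpow_neg (by positivity), Real.mul_rpow h1.le h2.le]
  have p1 : 0 < (b - t) ^ (-(1 / 2) : ℝ) := by positivity
  have p2 : 0 < (t - a) ^ (-(1 / 2) : ℝ) := by positivity
  rcases le_total ((b - a) / 2) (b - t) with h | h
  · have := Real.rpow_le_rpow_of_nonpos h3 h (by norm_num : (-(1 / 2) : ℝ) ≤ 0)
    nlinarith [Real.rpow_pos_of_pos h3 (-(1 / 2))]
  · have h' : (b - a) / 2 ≤ t - a := by linarith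
    have := Real.rpow_le_rpow_of_nonpos h3 h' (by norm_num : (-(1 / 2) : ℝ) ≤ 0)
    nlinarith [Real.rpow_pos_of_pos h3 (-(1 / 2))]

/-- The density has singularities of order `-1/2` at the endpoints, and `x` may lie at one of them,
so the exponent `-1/4` leaves a total order `-3/4 > -1`. The inequality `p² r ≤ p³ + r³` splits the
product into single `-3/4` powers, whose integrals are bounded uniformly in their center. -/
theorem exists_lintegral_arcsineMeasure_rpow_le {a b : ℝ} (h : a < b) :
    ∃ K : ℝ≥0∞, K < ⊤ ∧ ∀ x ∈ Set.Icc a b,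
      ∫⁻ t, ENNReal.ofReal (|t - x| ^ (-(1 / 4) : ℝ)) ∂arcsineMeasure a b ≤ K := by
  set J : ℝ≥0∞ := ∫⁻ t in Set.Ioo (-(b - a)) (b - a), ENNReal.ofReal (|t| ^ (-(3 / 4) : ℝ))
  have hJ : J < ⊤ := lintegral_abs_rpow_neg_lt_top (by norm_num) (by linarith)
  set c : ℝ := Real.pi⁻¹ * ((b - a) / 2) ^ (-(1 / 2) : ℝ)
  have hc : 0 ≤ c := by
    have : 0 < b - a := by linarith
    have := Real.pi_pos
    positivity
  refine ⟨ENNReal.ofReal c * (J + J + (J + J)), ?_, fun x hx => ?_⟩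
  · exact ENNReal.mul_lt_top ENNReal.ofReal_lt_top (by simp [hJ])
  have hq : ∀ t, ENNReal.ofReal ((Set.Ioo a b).indicator
      (fun β => 1 / (Real.pi * √((b - β) * (β - a)))) t) *
        ENNReal.ofReal (|t - x| ^ (-(1 / 4) : ℝ)) ≤
      (Set.Ioo a b).indicator (fun t => ENNReal.ofReal c *
        (ENNReal.ofReal (|t - a| ^ (-(3 / 4) : ℝ)) + ENNReal.ofReal (|t - b| ^ (-(3 / 4) : ℝ)) +
        (ENNReal.ofReal (|t - x| ^ (-(3 / 4) : ℝ)) +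
          ENNReal.ofReal (|t - x| ^ (-(3 / 4) : ℝ))))) t := by
    intro t
    by_cases ht : t ∈ Set.Ioo a b
    · simp only [Set.indicator_of_mem ht]
      rw [← ENNReal.ofReal_mul (by have := Real.pi_pos; positivity),
        ← ENNReal.ofReal_add (by positivity) (by positivity),
        ← ENNReal.ofReal_add (by positivity) (by positivity),
        ← ENNReal.ofReal_add (by positivity) (by positivity), ← ENNReal.ofReal_mul hc]
      refine ENNReal.ofReal_le_ofReal ?_
      have e2 : ∀ y : ℝ, 0 ≤ y → y ^ (-(1 / 2) : ℝ) = (y ^ (-(1 / 4) : ℝ)) ^ 2 := fun y hy => by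
        rw [← Real.rpow_natCast, ← Real.rpow_mul hy]; norm_num
      have e3 : ∀ y : ℝ, 0 ≤ y → y ^ (-(3 / 4) : ℝ) = (y ^ (-(1 / 4) : ℝ)) ^ 3 := fun y hy => by
        rw [← Real.rpow_natCast, ← Real.rpow_mul hy]; norm_num
      have k := one_div_sqrt_mul_le ht
      rw [e2 _ (abs_nonneg _), e2 _ (abs_nonneg _)] at k
      rw [e3 _ (abs_nonneg _), e3 _ (abs_nonneg _), e3 _ (abs_nonneg _)]
      set p := |t - a| ^ (-(1 / 4) : ℝ)
      set q := |t - b| ^ (-(1 / 4) : ℝ)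
      set r := |t - x| ^ (-(1 / 4) : ℝ)
      have hp : 0 ≤ p := by positivity
      have hq : 0 ≤ q := by positivity
      have hr : 0 ≤ r := by positivity
      calc 1 / (Real.pi * √((b - t) * (t - a))) * r
          = Real.pi⁻¹ * (1 / √((b - t) * (t - a)) * r) := by rw [one_div, mul_inv]; ring
        _ ≤ Real.pi⁻¹ * (((b - a) / 2) ^ (-(1 / 2) : ℝ) * (p ^ 2 + q ^ 2) * r) := by
            have := Real.pi_pos
            gcongr
        _ = c * (p ^ 2 * r + q ^ 2 * r) := by simp only [c]; ring
        _ ≤ c * (p ^ 3 + q ^ 3 + (r ^ 3 + r ^ 3)) := by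
            refine mul_le_mul_of_nonneg_left ?_ hc
            linarith [sq_mul_le_cube_add_cube hp hr, sq_mul_le_cube_add_cube hq hr]
    · simp [Set.indicator_of_notMem ht]
  have hm : ∀ y : ℝ, Measurable fun t : ℝ => ENNReal.ofReal (|t - y| ^ (-(3 / 4) : ℝ)) :=
    fun y => by fun_prop
  have hmd : Measurable fun t => ENNReal.ofReal ((Set.Ioo a b).indicator
      (fun β => 1 / (Real.pi * √((b - β) * (β - a)))) t) :=
    (Measurable.indicator (by fun_prop) measurableSet_Ioo).ennreal_ofReal
  rw [arcsineMeasure, lintegral_withDensity_eq_lintegral_mul _ hmd (by fun_prop)]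
  refine (lintegral_mono hq).trans ?_
  rw [lintegral_indicator measurableSet_Ioo, lintegral_const_mul _ (by fun_prop),
    lintegral_add_left (by fun_prop), lintegral_add_left (by fun_prop),
    lintegral_add_left (by fun_prop)]
  gcongr
  · exact lintegral_abs_sub_rpow_neg_le ⟨le_rfl, h.le⟩
  · exact lintegral_abs_sub_rpow_neg_le ⟨h.le, le_rfl⟩
  · exact lintegral_abs_sub_rpow_neg_le hx
  · exact lintegral_abs_sub_rpow_neg_le hx

theorem Real.exp_le_one_add_add_sq_mul_exp_abs (x : ℝ) :
    Real.exp x ≤ 1 + x + x ^ 2 * Real.exp |x| := by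
  have h0 : 1 ≤ Real.exp |x| := Real.one_le_exp (abs_nonneg x)
  have h1 : x ^ 2 ≤ x ^ 2 * Real.exp |x| := le_mul_of_one_le_right (sq_nonneg x) h0
  by_cases h : |x| ≤ 1
  · have := (abs_le.1 (Real.abs_exp_sub_one_sub_id_le h)).2
    linarith
  · rcases le_total 0 x with hx | hx
    · rw [abs_of_nonneg hx] at *
      have h2 : 1 ≤ x ^ 2 := by nlinarith
      nlinarith [Real.exp_pos x]
    · have h3 : Real.exp x ≤ 1 := Real.exp_le_one_iff.2 hx
      rw [abs_of_nonpos hx] at h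
      nlinarith

/-- A centered random variable with an exponential moment has a moment generating function
which is quadratically close to `1` near the origin. -/
theorem lintegral_exp_mul_le {X : Type*} [MeasurableSpace X] {ν : Measure X}
    [IsProbabilityMeasure ν] {Z : X → ℝ} (hZ : Integrable Z ν) (h0 : ∫ x, Z x ∂ν = 0) {K : ℝ}
    (hi : Integrable (fun x => Real.exp (|Z x| / 4)) ν)
    (hK : ∫ x, Real.exp (|Z x| / 4) ∂ν ≤ K) {s : ℝ} (hs : 0 ≤ s) (hs' : s ≤ 1 / 8) :
    ∫⁻ x, ENNReal.ofReal (Real.exp (s * Z x)) ∂ν ≤ ENNReal.ofReal (1 + 128 * s ^ 2 * K) := by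
  have hle : ∀ x, Real.exp (s * Z x) ≤
      1 + s * Z x + 128 * s ^ 2 * Real.exp (|Z x| / 4) := by
    intro x
    refine (Real.exp_le_one_add_add_sq_mul_exp_abs _).trans ?_
    -- Half of the available exponent `|Z| / 4` absorbs `Z ^ 2`, with constant `128 = 2 * 8 ^ 2`;
    -- the other half absorbs `exp |s * Z|`, because `s ≤ 1 / 8`.
    have h1 := Real.quadratic_le_exp_of_nonneg (x := |Z x| / 8) (by positivity)
    have h2 : Real.exp |s * Z x| ≤ Real.exp (|Z x| / 8) := by
      rw [Real.exp_le_exp, abs_mul, abs_of_nonneg hs]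
      nlinarith [abs_nonneg (Z x)]
    have h3 : Real.exp (|Z x| / 4) = Real.exp (|Z x| / 8) * Real.exp (|Z x| / 8) := by
      rw [← Real.exp_add]; ring_nf
    have h4 : (Z x) ^ 2 ≤ 128 * Real.exp (|Z x| / 8) := by
      rw [← sq_abs]; nlinarith [abs_nonneg (Z x)]
    have h5 : (s * Z x) ^ 2 * Real.exp |s * Z x| ≤ 128 * s ^ 2 * Real.exp (|Z x| / 4) := by
      calc (s * Z x) ^ 2 * Real.exp |s * Z x|
          ≤ s ^ 2 * (128 * Real.exp (|Z x| / 8)) * Real.exp (|Z x| / 8) := by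
            rw [mul_pow]; gcongr
        _ = 128 * s ^ 2 * Real.exp (|Z x| / 4) := by rw [h3]; ring
    linarith
  have hint : Integrable (fun x => 1 + s * Z x + 128 * s ^ 2 * Real.exp (|Z x| / 4)) ν :=
    ((integrable_const _).add (hZ.const_mul s)).add (hi.const_mul _)
  refine (lintegral_mono fun x => ENNReal.ofReal_le_ofReal (hle x)).trans ?_
  rw [← ofReal_integral_eq_lintegral_ofReal hint
    (ae_of_all _ fun x => (Real.exp_pos _).le.trans (hle x))]
  refine ENNReal.ofReal_le_ofReal ?_
  have hint1 : Integrable (fun x => 1 + s * Z x) ν := (integrable_const _).add (hZ.const_mul s)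
  rw [integral_add hint1 (hi.const_mul _), integral_add (integrable_const _) (hZ.const_mul s),
    integral_const_mul, integral_const_mul, h0]
  simp only [integral_const, probReal_univ, smul_eq_mul, mul_one, mul_zero, add_zero]
  gcongr

/-- The centered log contraction of a gradient step of inverse size `β` at curvature `l`. -/
noncomputable def logContraction (m M l β : ℝ) : ℝ :=
  Real.log |1 - l / β| - Real.log (acceleratedRate m M)

/-- For `z` the centered log contraction, `exp (|z| / 4) ≤ exp (z / 4) + exp (-z / 4)`. The first
term is bounded since `|1 - l / β| ≤ 1 + M / m`; the second is `(β ρ / |β - l|) ^ (1 / 4)`, whose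
integral is bounded uniformly in `l`. -/
theorem exists_exp_moment_logContraction {m M : ℝ} (hm : 0 < m) (hmM : m < M) :
    ∃ K : ℝ, 0 ≤ K ∧ ∀ l ∈ Set.Icc m M,
      Integrable (fun β => Real.exp (|logContraction m M l β| / 4)) (arcsineMeasure m M) ∧
      ∫ β, Real.exp (|logContraction m M l β| / 4) ∂arcsineMeasure m M ≤ K := by
  have := isProbabilityMeasure_arcsineMeasure hmM
  obtain ⟨J, hJ, hJle⟩ := exists_lintegral_arcsineMeasure_rpow_le hmM
  have hρ := acceleratedRate_pos hm hmM
  have hρ1 := acceleratedRate_lt_one (m := m) (M := M)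
  set ρ := acceleratedRate m M
  set A : ℝ := (1 + M / m) ^ (1 / 4 : ℝ) * ρ⁻¹ ^ (1 / 4 : ℝ)
  set B : ℝ := M ^ (1 / 4 : ℝ)
  have hM : 0 < M := hm.trans hmM
  have hA : 0 ≤ A := by positivity
  have hB : 0 ≤ B := by positivity
  have hpt : ∀ l ∈ Set.Icc m M, ∀ᵐ β ∂arcsineMeasure m M,
      Real.exp (|logContraction m M l β| / 4) ≤ A + B * |β - l| ^ (-(1 / 4) : ℝ) := by
    intro l hl
    filter_upwards [arcsineMeasure_ae_mem_Ioo m M,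
      (arcsineMeasure_absolutelyContinuous m M).ae_le (Measure.ae_ne volume l)] with β hβ hne
    have hβ0 : 0 < β := hm.trans hβ.1
    have hc : 0 < |1 - l / β| := by
      rw [one_sub_div hβ0.ne']
      exact abs_pos.2 (div_ne_zero (sub_ne_zero.2 hne) hβ0.ne')
    have hz : logContraction m M l β = Real.log (|1 - l / β| / ρ) := by
      rw [logContraction, Real.log_div hc.ne' hρ.ne']
    have h1 : Real.exp (logContraction m M l β / 4) ≤ A := by
      rw [hz, div_eq_mul_one_div (Real.log _), ← Real.rpow_def_of_pos (by positivity),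
        div_eq_mul_inv, Real.mul_rpow hc.le (by positivity)]
      have : |1 - l / β| ≤ 1 + M / m := by
        have h3 : l / β ≤ M / m := div_le_div₀ hM.le hl.2 hm hβ.1.le
        have h4 : 0 < l / β := div_pos (hm.trans_le hl.1) hβ0
        rw [abs_le]
        constructor <;> linarith
      simp only [A]
      gcongr
    have h2 : Real.exp (-logContraction m M l β / 4) ≤ B * |β - l| ^ (-(1 / 4) : ℝ) := by
      rw [hz, show -Real.log (|1 - l / β| / ρ) / 4 =
          Real.log (|1 - l / β| / ρ) * (-(1 / 4)) by ring,
        ← Real.rpow_def_of_pos (by positivity), one_sub_div hβ0.ne', abs_div, abs_of_pos hβ0,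
        div_div, Real.div_rpow (abs_nonneg _) (by positivity), div_eq_mul_inv, mul_comm,
        ← Real.rpow_neg (by positivity), neg_neg]
      gcongr
      simp only [B]
      have : β * ρ ≤ M := by nlinarith [hβ.2]
      gcongr
    have h3 : 0 < Real.exp (logContraction m M l β / 4) := Real.exp_pos _
    have h4 : 0 < Real.exp (-logContraction m M l β / 4) := Real.exp_pos _
    rcases abs_choice (logContraction m M l β) with h | h <;> rw [h] <;>
    linarith
  refine ⟨A + B * J.toReal, by positivity, fun l hl => ?_⟩
  have hmr : Measurable fun β : ℝ => |β - l| ^ (-(1 / 4) : ℝ) := by fun_prop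
  have hfin : ∫⁻ β, ENNReal.ofReal (|β - l| ^ (-(1 / 4) : ℝ)) ∂arcsineMeasure m M < ⊤ :=
    (hJle l hl).trans_lt hJ
  have hir : Integrable (fun β : ℝ => |β - l| ^ (-(1 / 4) : ℝ)) (arcsineMeasure m M) := by
    refine ⟨hmr.aestronglyMeasurable, ?_⟩
    rw [hasFiniteIntegral_iff_ofReal (ae_of_all _ fun β => by positivity)]
    exact hfin
  have hib := (integrable_const A).add (hir.const_mul B)
  have hi : Integrable (fun β => Real.exp (|logContraction m M l β| / 4))
      (arcsineMeasure m M) := by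
    refine hib.mono' ?_ ?_
    · unfold logContraction
      exact Measurable.aestronglyMeasurable (by fun_prop)
    · filter_upwards [hpt l hl] with β hβ
      rw [Real.norm_eq_abs, abs_of_pos (Real.exp_pos _)]
      exact hβ
  refine ⟨hi, ?_⟩
  refine (integral_mono_ae hi hib (hpt l hl)).trans ?_
  simp only [Pi.add_apply]
  rw [integral_add (integrable_const A) (hir.const_mul B), integral_const_mul B,
    integral_eq_lintegral_of_nonneg_ae (ae_of_all _ fun β => by positivity)
      hmr.aestronglyMeasurable]
  simp only [integral_const, probReal_univ, one_smul]
  gcongr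
  · exact hJ.ne
  · exact hJle l hl

theorem integral_logContraction {m M l : ℝ} (hm : 0 < m) (hmM : m < M)
    (hl : l ∈ Set.Icc m M) :
    Integrable (logContraction m M l) (arcsineMeasure m M) ∧
      ∫ β, logContraction m M l β ∂arcsineMeasure m M = 0 := by
  have := isProbabilityMeasure_arcsineMeasure hmM
  obtain ⟨i, e⟩ := integral_log_one_sub_div_arcsineMeasure hm hmM hl
  refine ⟨i.sub (integrable_const _), ?_⟩
  simp only [logContraction]
  rw [integral_sub i (integrable_const _), e]
  simp

theorem exists_chernoff_logContraction {m M : ℝ} (hm : 0 < m) (hmM : m < M) {δ : ℝ}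
    (hδ : 0 < δ) :
    ∃ s q : ℝ, 0 < s ∧ 0 ≤ q ∧ q < 1 ∧ ∀ l ∈ Set.Icc m M,
      ∫⁻ β, ENNReal.ofReal (Real.exp (s * (logContraction m M l β - δ)))
        ∂arcsineMeasure m M ≤ ENNReal.ofReal q ∧
      ∫⁻ β, ENNReal.ofReal (Real.exp (s * (-logContraction m M l β - δ)))
        ∂arcsineMeasure m M ≤ ENNReal.ofReal q := by
  have := isProbabilityMeasure_arcsineMeasure hmM
  obtain ⟨K, hK0, hK⟩ := exists_exp_moment_logContraction hm hmM
  -- With this choice `128 * s ^ 2 * K ≤ s * δ / 2`: the quadratic error of the moment generating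
  -- function costs at most half of the gain `s * δ`. Writing `K + 1` avoids division by zero.
  set s : ℝ := min (1 / 8) (δ / (256 * (K + 1)))
  have hs : 0 < s := lt_min (by norm_num) (by positivity)
  have hs8 : s ≤ 1 / 8 := min_le_left _ _
  have hsK : s * (256 * (K + 1)) ≤ δ := by
    rw [← le_div_iff₀ (by positivity)]; exact min_le_right _ _
  refine ⟨s, Real.exp (-(s * δ / 2)), hs, (Real.exp_pos _).le,
    Real.exp_lt_one_iff.2 (by have := mul_pos hs hδ; linarith), fun l hl => ?_⟩
  obtain ⟨i, e⟩ := integral_logContraction hm hmM hl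
  obtain ⟨j, k⟩ := hK l hl
  have key : ∀ Z : ℝ → ℝ, Integrable Z (arcsineMeasure m M) →
      ∫ β, Z β ∂arcsineMeasure m M = 0 →
      Integrable (fun β => Real.exp (|Z β| / 4)) (arcsineMeasure m M) →
      ∫ β, Real.exp (|Z β| / 4) ∂arcsineMeasure m M ≤ K →
      ∫⁻ β, ENNReal.ofReal (Real.exp (s * (Z β - δ))) ∂arcsineMeasure m M ≤
        ENNReal.ofReal (Real.exp (-(s * δ / 2))) := by
    intro Z h1 h2 h3 h4
    have hle := lintegral_exp_mul_le h1 h2 h3 h4 hs.le hs8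
    have : ∀ β, ENNReal.ofReal (Real.exp (s * (Z β - δ))) =
        ENNReal.ofReal (Real.exp (-(s * δ))) * ENNReal.ofReal (Real.exp (s * Z β)) := by
      intro β
      rw [← ENNReal.ofReal_mul (Real.exp_pos _).le, ← Real.exp_add]
      ring_nf
    simp_rw [this]
    rw [lintegral_const_mul' _ _ ENNReal.ofReal_ne_top]
    refine (mul_le_mul_right hle _).trans ?_
    rw [← ENNReal.ofReal_mul (Real.exp_pos _).le]
    refine ENNReal.ofReal_le_ofReal ?_
    calc Real.exp (-(s * δ)) * (1 + 128 * s ^ 2 * K)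
        ≤ Real.exp (-(s * δ)) * Real.exp (128 * s ^ 2 * K) := by
          gcongr
          linarith [Real.add_one_le_exp (128 * s ^ 2 * K)]
      _ = Real.exp (-(s * δ) + 128 * s ^ 2 * K) := by rw [Real.exp_add]
      _ ≤ Real.exp (-(s * δ / 2)) := by
          rw [Real.exp_le_exp]
          nlinarith
  refine ⟨key _ i e j k, ?_⟩
  refine key (fun β => -logContraction m M l β) i.neg ?_ ?_ ?_
  · rw [integral_neg, e, neg_zero]
  · simpa using j
  · simpa using k

/-! ### Law of large numbers along adapted parameters -/

/-- The information carried by the first `t` random variables of the sequence `β`. -/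
@[reducible]
def history {Ω : Type*} (β : ℕ → Ω → ℝ) (t : ℕ) : MeasurableSpace Ω :=
  ⨆ i ∈ {i | i < t}, MeasurableSpace.comap (β i) inferInstance

theorem history_mono {Ω : Type*} (β : ℕ → Ω → ℝ) {s t : ℕ} (h : s ≤ t) :
    history β s ≤ history β t :=
  biSup_mono fun _ hi => lt_of_lt_of_le hi h

theorem measurable_history {Ω : Type*} (β : ℕ → Ω → ℝ) {s t : ℕ} (h : s < t) :
    Measurable[history β t] (β s) := by
  rw [measurable_iff_comap_le]
  exact le_iSup₂ (f := fun i (_ : i ∈ {i | i < t}) => MeasurableSpace.comap (β i) inferInstance)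
    s h

section Adapted

variable {Ω : Type*} [mΩ : MeasurableSpace Ω] {P : Measure Ω} [IsProbabilityMeasure P]
  {β : ℕ → Ω → ℝ} {σ : Measure ℝ} [IsProbabilityMeasure σ]

theorem history_le (hm : ∀ t, Measurable (β t)) (t : ℕ) : history β t ≤ mΩ :=
  iSup₂_le fun i _ => (hm i).comap_le

/-- Freezing: `β t` is independent of the past, so it can be integrated out with `W` and `L` held
fixed. -/
theorem lintegral_mul_of_history (hm : ∀ t, Measurable (β t)) (hi : iIndepFun β P)
    (hl : ∀ t, P.map (β t) = σ) (t : ℕ) {W : Ω → ℝ≥0∞} (hW : Measurable[history β t] W)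
    {L : Ω → ℝ} (hL : Measurable[history β t] L) {g : ℝ → ℝ → ℝ≥0∞}
    (hg : Measurable (Function.uncurry g)) :
    ∫⁻ ω, W ω * g (L ω) (β t ω) ∂P = ∫⁻ ω, W ω * ∫⁻ b, g (L ω) b ∂σ ∂P := by
  have hind : Indep (history β t) (MeasurableSpace.comap (β t) inferInstance) P := by
    have := indep_iSup_of_disjoint (S := {i | i < t}) (T := {t})
      (fun k => (hm k).comap_le) hi (by simp)
    rwa [iSup_singleton] at this
  have hp : Measurable[history β t] fun ω => (W ω, L ω) := hW.prodMk hL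
  have hp' : Measurable fun ω => (W ω, L ω) := hp.mono (history_le hm t) le_rfl
  have hif : IndepFun (fun ω => (W ω, L ω)) (β t) P := by
    rw [IndepFun_iff_Indep]
    exact indep_of_indep_of_le_left hind hp.comap_le
  have hG : Measurable fun z : (ℝ≥0∞ × ℝ) × ℝ => z.1.1 * g z.1.2 z.2 :=
    (measurable_fst.comp measurable_fst).mul
      (hg.comp ((measurable_snd.comp measurable_fst).prodMk measurable_snd))
  have hmap := (indepFun_iff_map_prod_eq_prod_map_map hp'.aemeasurable (hm t).aemeasurable).1 hif
  have e1 := lintegral_map (μ := P) hG (hp'.prodMk (hm t))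
  rw [hmap, hl] at e1
  rw [← e1]
  have : IsProbabilityMeasure (P.map fun ω => (W ω, L ω)) :=
    Measure.isProbabilityMeasure_map hp'.aemeasurable
  rw [lintegral_prod _ hG.aemeasurable, lintegral_map hG.lintegral_prod_right' hp']
  refine lintegral_congr fun ω => ?_
  rw [lintegral_const_mul]
  exact hg.comp measurable_prodMk_left

/-- Given the past, the newest factor integrates to at most `q` whatever the adapted parameter is,
so each step costs one factor `q`. -/
theorem lintegral_prod_le_pow (hm : ∀ t, Measurable (β t)) (hi : iIndepFun β P)
    (hl : ∀ t, P.map (β t) = σ) {L : ℕ → Ω → ℝ} (hL : ∀ t, Measurable[history β t] (L t))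
    {S : Set ℝ} (hS : ∀ t ω, L t ω ∈ S) {g : ℝ → ℝ → ℝ≥0∞}
    (hg : Measurable (Function.uncurry g)) {q : ℝ≥0∞} (hq : ∀ l ∈ S, ∫⁻ b, g l b ∂σ ≤ q)
    (n : ℕ) :
    ∫⁻ ω, ∏ i ∈ Finset.range n, g (L i ω) (β i ω) ∂P ≤ q ^ n := by
  induction n with
  | zero => simp
  | succ n ih =>
    have hW : Measurable[history β n] fun ω => ∏ i ∈ Finset.range n, g (L i ω) (β i ω) := by
      refine Finset.measurable_prod _ fun i hin => ?_
      have hin' := Finset.mem_range.1 hin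
      exact hg.comp (((hL i).mono (history_mono β hin'.le) le_rfl).prodMk
        (measurable_history β hin'))
    simp_rw [Finset.prod_range_succ]
    rw [lintegral_mul_of_history hm hi hl n hW (hL n) hg]
    calc ∫⁻ ω, (∏ i ∈ Finset.range n, g (L i ω) (β i ω)) * ∫⁻ b, g (L n ω) b ∂σ ∂P
        ≤ ∫⁻ ω, (∏ i ∈ Finset.range n, g (L i ω) (β i ω)) * q ∂P :=
          lintegral_mono fun ω => mul_le_mul_right (hq _ (hS n ω)) _
      _ = (∫⁻ ω, ∏ i ∈ Finset.range n, g (L i ω) (β i ω) ∂P) * q :=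
          lintegral_mul_const _ (hW.mono (history_le hm n) le_rfl)
      _ ≤ q ^ (n + 1) := by rw [pow_succ]; exact mul_le_mul_left ih _

/-- A variable with atomless law almost surely misses a value determined by an independent past.
This rules out the factors `1 - l / β = 0`, which logarithms cannot see because `Real.log 0 = 0`. -/
theorem ae_forall_ne_of_history [NullSingletonClass σ] (hm : ∀ t, Measurable (β t))
    (hi : iIndepFun β P)
    (hl : ∀ t, P.map (β t) = σ) {L : ℕ → Ω → ℝ} (hL : ∀ t, Measurable[history β t] (L t)) :
    ∀ᵐ ω ∂P, ∀ t, β t ω ≠ L t ω := by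
  rw [ae_all_iff]
  intro t
  set D : Set (ℝ × ℝ) := {z | z.2 = z.1}
  have hD : MeasurableSet D := measurableSet_eq_fun measurable_snd measurable_fst
  have h := lintegral_mul_of_history hm hi hl t (W := 1) measurable_const (hL t)
    (g := fun l b => D.indicator 1 (l, b)) (measurable_one.indicator hD)
  have h0 : ∀ l : ℝ, ∫⁻ b, D.indicator 1 (l, b) ∂σ = 0 := by
    intro l
    have : ∀ b, D.indicator (1 : ℝ × ℝ → ℝ≥0∞) (l, b) = ({l} : Set ℝ).indicator 1 b := by
      intro b
      by_cases hb : b = l <;> simp [D, hb, Set.indicator]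
    simp_rw [this]
    rw [lintegral_indicator_one (measurableSet_singleton l), measure_singleton]
  simp only [h0, mul_zero, lintegral_zero, Pi.one_apply, one_mul] at h
  have hmeas : Measurable fun ω => D.indicator (1 : ℝ × ℝ → ℝ≥0∞) (L t ω, β t ω) :=
    (measurable_one.indicator hD).comp (((hL t).mono (history_le hm t) le_rfl).prodMk (hm t))
  rw [lintegral_eq_zero_iff hmeas] at h
  filter_upwards [h] with ω hω hne
  have : (L t ω, β t ω) ∈ D := hne
  simp [Set.indicator_of_mem this] at hω

/-- Chernoff and Borel–Cantelli in one step: the products of exponentials have geometrically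
decaying expectations, so their series converges almost surely and they are eventually below `1`,
which is the bound on the sum. -/
theorem ae_eventually_sum_le (hm : ∀ t, Measurable (β t)) (hi : iIndepFun β P)
    (hl : ∀ t, P.map (β t) = σ) {L : ℕ → Ω → ℝ} (hL : ∀ t, Measurable[history β t] (L t))
    {S : Set ℝ} (hS : ∀ t ω, L t ω ∈ S) {Z : ℝ → ℝ → ℝ} (hZ : Measurable (Function.uncurry Z))
    {s q δ : ℝ} (hs : 0 < s) (hq1 : q < 1)
    (hq : ∀ l ∈ S, ∫⁻ b, ENNReal.ofReal (Real.exp (s * (Z l b - δ))) ∂σ ≤ ENNReal.ofReal q) :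
    ∀ᵐ ω ∂P, ∀ᶠ n : ℕ in atTop, ∑ i ∈ Finset.range n, Z (L i ω) (β i ω) ≤ n * δ := by
  set g : ℝ → ℝ → ℝ≥0∞ := fun l b => ENNReal.ofReal (Real.exp (s * (Z l b - δ)))
  have hg : Measurable (Function.uncurry g) :=
    (Real.measurable_exp.comp ((hZ.sub_const δ).const_mul s)).ennreal_ofReal
  have hgm : ∀ n, Measurable fun ω => ∏ i ∈ Finset.range n, g (L i ω) (β i ω) := fun n =>
    Finset.measurable_prod _ fun i _ =>
      hg.comp (((hL i).mono (history_le hm i) le_rfl).prodMk (hm i))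
  have hsum : ∫⁻ ω, ∑' n, ∏ i ∈ Finset.range n, g (L i ω) (β i ω) ∂P ≠ ⊤ := by
    rw [lintegral_tsum fun n => (hgm n).aemeasurable]
    refine ne_top_of_le_ne_top ?_
      (ENNReal.tsum_le_tsum fun n => lintegral_prod_le_pow hm hi hl hL hS hg hq n)
    rw [ENNReal.tsum_geometric]
    simpa [tsub_eq_zero_iff_le] using hq1
  filter_upwards [ae_lt_top (Measurable.tsum hgm) hsum] with ω hω
  have ht := ENNReal.tendsto_atTop_zero_of_tsum_ne_top hω.ne
  filter_upwards [ht.eventually_lt_const zero_lt_one] with n hn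
  by_contra! hcon
  refine absurd hn (not_lt.2 ?_)
  simp only [g]
  rw [← ENNReal.ofReal_prod_of_nonneg fun i _ => (Real.exp_pos _).le, ← Real.exp_sum,
    ← Finset.mul_sum, Finset.sum_sub_distrib, Finset.sum_const, Finset.card_range, nsmul_eq_mul,
    ENNReal.one_le_ofReal, Real.one_le_exp_iff]
  exact mul_nonneg hs.le (by linarith)

end Adapted

instance nullSingletonClass_arcsineMeasure (a b : ℝ) : NullSingletonClass (arcsineMeasure a b) :=
  ⟨fun _ => arcsineMeasure_absolutelyContinuous a b (measure_singleton _)⟩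

/-- Law of large numbers for the log contractions along adapted curvatures. -/
theorem ae_forall_eventually_abs_sum_logContraction_le {m M : ℝ} (h0 : 0 < m) (hmM : m < M)
    {Ω : Type*} [MeasurableSpace Ω] {P : Measure Ω} [IsProbabilityMeasure P] {β : ℕ → Ω → ℝ}
    (hm : ∀ t, Measurable (β t)) (hi : iIndepFun β P)
    (hl : ∀ t, P.map (β t) = arcsineMeasure m M) {L : ℕ → Ω → ℝ}
    (hL : ∀ t, Measurable[history β t] (L t)) (hS : ∀ t ω, L t ω ∈ Set.Icc m M) :
    ∀ᵐ ω ∂P, ∀ δ > 0, ∀ᶠ n : ℕ in atTop,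
      |∑ i ∈ Finset.range n, logContraction m M (L i ω) (β i ω)| ≤ n * δ := by
  have := isProbabilityMeasure_arcsineMeasure hmM
  have hZ : Measurable (Function.uncurry (logContraction m M)) := by
    unfold Function.uncurry logContraction; fun_prop
  have key : ∀ k : ℕ, ∀ᵐ ω ∂P, ∀ᶠ n : ℕ in atTop,
      |∑ i ∈ Finset.range n, logContraction m M (L i ω) (β i ω)| ≤ n * (1 / ((k : ℝ) + 1)) := by
    intro k
    obtain ⟨s, q, hs, -, hq1, hq⟩ := exists_chernoff_logContraction h0 hmM
      (δ := 1 / ((k : ℝ) + 1)) (by positivity)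
    filter_upwards [ae_eventually_sum_le hm hi hl hL hS hZ hs hq1 fun l hl => (hq l hl).1,
      ae_eventually_sum_le hm hi hl hL hS (Z := fun l b => -logContraction m M l b) hZ.neg hs hq1
        fun l hl => (hq l hl).2] with ω h1 h2
    filter_upwards [h1, h2] with n h1 h2
    rw [Finset.sum_neg_distrib] at h2
    rw [abs_le]
    constructor <;> linarith
  filter_upwards [ae_all_iff.2 key] with ω hω δ hδ
  obtain ⟨k, hk⟩ := exists_nat_one_div_lt hδ
  filter_upwards [hω k] with n hn
  refine hn.trans ?_
  gcongr

/-! ### Radially-separable functions and block curvatures -/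

theorem exists_linearIsometryEquiv_mulVec {d : ℕ} {U : Matrix (Fin d) (Fin d) ℝ}
    (hU : U ∈ Matrix.orthogonalGroup (Fin d) ℝ) :
    ∃ A : EuclideanSpace ℝ (Fin d) ≃ₗᵢ[ℝ] EuclideanSpace ℝ (Fin d),
      ∀ x i, A x i = (U.mulVec x.ofLp) i := by
  have hU' : U.transpose * U = 1 := (Matrix.mem_orthogonalGroup_iff' (Fin d) ℝ).1 hU
  let T : EuclideanSpace ℝ (Fin d) →ₗ[ℝ] EuclideanSpace ℝ (Fin d) :=
    { toFun := fun x => WithLp.toLp 2 (U.mulVec x.ofLp)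
      map_add' := fun x y => by ext i; simp [Matrix.mulVec_add]
      map_smul' := fun c x => by ext i; simp [Matrix.mulVec_smul] }
  have hT : ∀ x, ‖T x‖ = ‖x‖ := by
    intro x
    have h1 : ∀ y : EuclideanSpace ℝ (Fin d), ‖y‖ ^ 2 = y.ofLp ⬝ᵥ y.ofLp := by
      intro y
      rw [EuclideanSpace.real_norm_sq_eq]
      simp [dotProduct, sq]
    rw [← sq_eq_sq₀ (norm_nonneg _) (norm_nonneg _), h1, h1]
    change U.mulVec x.ofLp ⬝ᵥ U.mulVec x.ofLp = _
    rw [Matrix.dotProduct_mulVec, ← Matrix.mulVec_transpose, Matrix.mulVec_mulVec, hU',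
      Matrix.one_mulVec]
  exact ⟨(⟨T, hT⟩ : EuclideanSpace ℝ (Fin d) →ₗᵢ[ℝ] _).toLinearIsometryEquiv rfl,
    fun x i => rfl⟩

/-- Up to an isometry, a radially-separable function is a sum over the blocks of a partition of
functions of the squared distance to a common center. -/
theorem IsRadiallySeparable.exists_normalForm {d : ℕ} {f : EuclideanSpace ℝ (Fin d) → ℝ}
    (hf : IsRadiallySeparable f) :
    ∃ (A : EuclideanSpace ℝ (Fin d) ≃ₗᵢ[ℝ] EuclideanSpace ℝ (Fin d))
      (π : Finpartition (Finset.univ : Finset (Fin d))) (h : Finset (Fin d) → ℝ → ℝ)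
      (p : EuclideanSpace ℝ (Fin d)),
      ∀ x, f x = ∑ S ∈ π.parts, h S (∑ i ∈ S, (A (x - p) i) ^ 2) := by
  obtain ⟨U, hU, π, r, hr, hf⟩ := hf
  obtain ⟨A, hA⟩ := exists_linearIsometryEquiv_mulVec hU
  have hr' : ∀ S : Finset (Fin d), ∃ (h : ℝ → ℝ) (c : EuclideanSpace ℝ S),
      S ∈ π.parts → ∀ x, r S x = h ‖x - c‖ := by
    intro S
    by_cases hS : S ∈ π.parts
    · obtain ⟨h, c, hh⟩ := hr S hS
      exact ⟨h, c, fun _ => hh⟩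
    · exact ⟨0, 0, fun h => absurd h hS⟩
  choose h c hc using hr'
  -- The blocks are disjoint and cover all coordinates, so their centers glue to one point; its
  -- preimage under `A` is the common center.
  let q : EuclideanSpace ℝ (Fin d) := WithLp.toLp 2 fun i =>
    c (π.part i) ⟨i, (π.mem_part_self).2 (Finset.mem_univ i)⟩
  refine ⟨A, π, fun S s => h S √s, A.symm q, fun x => ?_⟩
  rw [hf]
  refine Finset.sum_congr rfl fun S hS => ?_
  rw [hc S hS, EuclideanSpace.norm_eq]
  congr 2
  rw [← Finset.sum_coe_sort S]
  refine Finset.sum_congr rfl fun i _ => ?_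
  rw [map_sub, LinearIsometryEquiv.apply_symm_apply, Real.norm_eq_abs, sq_abs]
  have hq : q i = c S i := by
    have hS' : π.part i = S := π.part_eq_of_mem hS i.2
    have : ∀ T (hT : π.part i = T) (hi : (i : Fin d) ∈ T),
        c (π.part i) ⟨i, (π.mem_part_self).2 (Finset.mem_univ _)⟩ = c T ⟨i, hi⟩ := by
      rintro T rfl hi; rfl
    exact this S hS' i.2
  simp only [PiLp.sub_apply, hq, blockCoords, hA]

/-- On the segment from `y` to `x`, `f - m / 2 * ‖·‖ ^ 2` is a convex function of one variable, so
its derivative at `0` is at most that at `1`. -/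
theorem StrongConvexOn.mul_norm_sub_sq_le {E : Type*} [NormedAddCommGroup E]
    [InnerProductSpace ℝ E] [CompleteSpace E] {m : ℝ} {f : E → ℝ}
    (hf : StrongConvexOn Set.univ m f) (hd : Differentiable ℝ f) (x y : E) :
    m * ‖x - y‖ ^ 2 ≤ inner ℝ (gradient f x - gradient f y) (x - y) := by
  have hg := strongConvexOn_iff_convex.1 hf
  set v := x - y with hv
  have hφ : ConvexOn ℝ Set.univ fun t : ℝ => f (y + t • v) - m / 2 * ‖y + t • v‖ ^ 2 := by
    have := hg.comp_affineMap (AffineMap.lineMap y x : ℝ →ᵃ[ℝ] E)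
    simp only [Set.preimage_univ, Function.comp_def, AffineMap.lineMap_apply, vsub_eq_sub,
      vadd_eq_add] at this
    simpa only [add_comm] using this
  have hder : ∀ t : ℝ, HasDerivAt (fun t : ℝ => f (y + t • v) - m / 2 * ‖y + t • v‖ ^ 2)
      (inner ℝ (gradient f (y + t • v)) v - m * (inner ℝ y v + t * ‖v‖ ^ 2)) t := by
    intro t
    have h1 : HasDerivAt (fun t : ℝ => y + t • v) v t := by
      simpa using ((hasDerivAt_id t).smul_const v).const_add y
    have h2 : HasDerivAt (fun t : ℝ => f (y + t • v)) (inner ℝ (gradient f (y + t • v)) v) t := by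
      rw [inner_gradient_left]
      exact ((hd _).hasFDerivAt).comp_hasDerivAt t h1
    have h3 : HasDerivAt (fun t : ℝ => m / 2 * ‖y + t • v‖ ^ 2)
        (m * (inner ℝ y v + t * ‖v‖ ^ 2)) t := by
      refine (h1.norm_sq.const_mul (m / 2)).congr_deriv ?_
      rw [inner_add_left, real_inner_smul_left, real_inner_self_eq_norm_sq]
      ring
    exact h2.sub h3
  have a0 := hφ.le_slope_of_hasDerivAt (Set.mem_univ 0) (Set.mem_univ 1) zero_lt_one (hder 0)
  have a1 := hφ.slope_le_of_hasDerivAt (Set.mem_univ 0) (Set.mem_univ 1) zero_lt_one (hder 1)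
  have := a0.trans a1
  rw [zero_smul, one_smul, add_zero, zero_mul, add_zero, one_mul,
    show y + v = x by rw [hv]; abel] at this
  rw [inner_sub_left]
  linarith

theorem HasDerivAt.eq_zero_of_even {φ : ℝ → ℝ} {c : ℝ} (h : HasDerivAt φ c 0)
    (he : ∀ t, φ (-t) = φ t) : c = 0 := by
  have h1 : HasDerivAt (fun t => φ (-t)) (-c) 0 := by
    have h' : HasDerivAt φ c (-0) := by rwa [neg_zero]
    simpa [Function.comp_def] using h'.comp (0 : ℝ) (hasDerivAt_neg (0 : ℝ))
  simp only [he] at h1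
  have := h.unique h1
  linarith

section Curvature

variable {d : ℕ} {m M : ℝ} {f : EuclideanSpace ℝ (Fin d) → ℝ}
  {A : EuclideanSpace ℝ (Fin d) ≃ₗᵢ[ℝ] EuclideanSpace ℝ (Fin d)}
  {π : Finpartition (Finset.univ : Finset (Fin d))} {h : Finset (Fin d) → ℝ → ℝ}
  {p : EuclideanSpace ℝ (Fin d)}

/-- Moving by `t` in a block direction orthogonal to the displacement changes the squared distance
by a multiple of `t ^ 2`. So `f` is even in `t` and its directional derivative vanishes, without any
regularity of the profiles `h`. -/
theorem sum_gradient_mul_eq_zero (hd : Differentiable ℝ f)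
    (hf : ∀ x, f x = ∑ S ∈ π.parts, h S (∑ i ∈ S, (A (x - p) i) ^ 2))
    {S : Finset (Fin d)} (hS : S ∈ π.parts) (x ω : EuclideanSpace ℝ (Fin d))
    (hω : ∀ i ∉ S, ω i = 0) (hz : ∑ i ∈ S, A (x - p) i * ω i = 0) :
    ∑ i ∈ S, A (gradient f x) i * ω i = 0 := by
  have h1 : HasDerivAt (fun t : ℝ => f (x + t • A.symm ω))
      (inner ℝ (gradient f x) (A.symm ω)) 0 := by
    rw [inner_gradient_left]
    have hl : HasDerivAt (fun t : ℝ => x + t • A.symm ω) (A.symm ω) 0 := by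
      simpa using ((hasDerivAt_id (0 : ℝ)).smul_const (A.symm ω)).const_add x
    refine HasFDerivAt.comp_hasDerivAt 0 ?_ hl
    simpa using (hd x).hasFDerivAt
  have h2 := h1.eq_zero_of_even fun t => by
    simp only [hf]
    refine Finset.sum_congr rfl fun T hT => ?_
    congr 1
    have hcross : ∑ i ∈ T, A (x - p) i * ω i = 0 := by
      by_cases hTS : T = S
      · rw [hTS, hz]
      · refine Finset.sum_eq_zero fun i hi => ?_
        rw [hω i fun hiS => hTS (π.eq_of_mem_parts hT hS hi hiS), mul_zero]
    have hexp : ∀ u : ℝ, ∑ i ∈ T, (A (x + u • A.symm ω - p) i) ^ 2 =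
        ∑ i ∈ T, (A (x - p) i) ^ 2 + u ^ 2 * ∑ i ∈ T, (ω i) ^ 2 := by
      intro u
      rw [show x + u • A.symm ω - p = (x - p) + u • A.symm ω by abel, map_add, map_smul,
        LinearIsometryEquiv.apply_symm_apply]
      simp only [PiLp.add_apply, PiLp.smul_apply, smul_eq_mul]
      have : ∀ i, (A (x - p) i + u * ω i) ^ 2 =
          (A (x - p) i) ^ 2 + 2 * u * (A (x - p) i * ω i) + u ^ 2 * (ω i) ^ 2 := fun i => by ring
      simp_rw [this, Finset.sum_add_distrib, ← Finset.mul_sum, hcross, mul_zero, add_zero]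
    rw [hexp, hexp, neg_sq]
  rw [← A.inner_map_map, LinearIsometryEquiv.apply_symm_apply, PiLp.inner_apply] at h2
  rw [← h2, ← Finset.sum_subset (Finset.subset_univ S)]
  · refine Finset.sum_congr rfl fun i _ => ?_
    simp [mul_comm]
  · intro i _ hi
    simp [hω i hi]

/-- The curvature seen by a gradient step at `x` in the block `S`: the gradient of `f` at `x` is
`blockCurvature` times the displacement from the center, in the coordinates of the block. -/
noncomputable def blockCurvature (m : ℝ) (f : EuclideanSpace ℝ (Fin d) → ℝ)
    (A : EuclideanSpace ℝ (Fin d) ≃ₗᵢ[ℝ] EuclideanSpace ℝ (Fin d))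
    (p : EuclideanSpace ℝ (Fin d)) (S : Finset (Fin d)) (x : EuclideanSpace ℝ (Fin d)) : ℝ :=
  -- The quotient is meaningless at zero displacement. There the block gradient vanishes too, so any
  -- value works; `m` stays in `[m, M]`.
  if ∑ i ∈ S, (A (x - p) i) ^ 2 = 0 then m else
    (∑ i ∈ S, A (gradient f x) i * A (x - p) i) / ∑ i ∈ S, (A (x - p) i) ^ 2

/-- The residual `ω = G - l z` on the block is orthogonal to `z` by the choice of `l`, hence
orthogonal to `G` by symmetry, hence to itself. -/
theorem gradient_eq_blockCurvature_mul (hd : Differentiable ℝ f)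
    (hf : ∀ x, f x = ∑ S ∈ π.parts, h S (∑ i ∈ S, (A (x - p) i) ^ 2))
    {S : Finset (Fin d)} (hS : S ∈ π.parts) (x : EuclideanSpace ℝ (Fin d)) {i : Fin d}
    (hi : i ∈ S) : A (gradient f x) i = blockCurvature m f A p S x * A (x - p) i := by
  set G := A (gradient f x) with hG
  set z := A (x - p) with hz
  set l := blockCurvature m f A p S x with hl
  have hzz : ∑ i ∈ S, (G i - l * z i) * z i = 0 := by
    by_cases h0 : ∑ i ∈ S, (z i) ^ 2 = 0
    · refine Finset.sum_eq_zero fun j hj => ?_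
      have := (Finset.sum_eq_zero_iff_of_nonneg fun j _ => sq_nonneg (z j)).1 h0 j hj
      rw [pow_eq_zero_iff two_ne_zero] at this
      rw [this, mul_zero]
    · have : ∀ i, (G i - l * z i) * z i = G i * z i - l * (z i) ^ 2 := fun i => by ring
      simp_rw [this, Finset.sum_sub_distrib, ← Finset.mul_sum]
      rw [hl, blockCurvature, if_neg h0, div_mul_cancel₀ _ h0, sub_self]
  let ω : EuclideanSpace ℝ (Fin d) := WithLp.toLp 2 fun j => if j ∈ S then G j - l * z j else 0
  have hω1 : ∀ j ∈ S, ω j = G j - l * z j := fun j hj => by simp [ω, hj]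
  have hzω : ∑ i ∈ S, z i * ω i = 0 := by
    rw [← hzz]
    exact Finset.sum_congr rfl fun j hj => by rw [hω1 j hj, mul_comm]
  have hGω := sum_gradient_mul_eq_zero hd hf hS x ω (fun j hj => by simp [ω, hj]) hzω
  have hsq : ∑ j ∈ S, (G j - l * z j) ^ 2 = 0 := by
    have : ∀ j ∈ S, (G j - l * z j) ^ 2 = G j * ω j - l * (z j * ω j) := fun j hj => by
      rw [hω1 j hj]; ring
    rw [Finset.sum_congr rfl this, Finset.sum_sub_distrib, ← Finset.mul_sum, hGω, hzω, mul_zero,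
      sub_zero]
  have := (Finset.sum_eq_zero_iff_of_nonneg fun j _ => sq_nonneg (G j - l * z j)).1 hsq i hi
  rw [pow_eq_zero_iff two_ne_zero] at this
  linarith

/-- Compare `x` with the point `x'` whose displacement in the block is set to zero. As `x - x'`
lives in the block, the inner product of the gradient difference with it is `l * ‖x - x'‖ ^ 2`,
which strong monotonicity and the Lipschitz bound pinch. -/
theorem blockCurvature_mem_Icc (hmM : m ≤ M) (hsc : StrongConvexOn Set.univ m f)
    (hsm : IsSmoothWith M f)
    (hf : ∀ x, f x = ∑ S ∈ π.parts, h S (∑ i ∈ S, (A (x - p) i) ^ 2))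
    {S : Finset (Fin d)} (hS : S ∈ π.parts) (x : EuclideanSpace ℝ (Fin d)) :
    blockCurvature m f A p S x ∈ Set.Icc m M := by
  by_cases h0 : ∑ i ∈ S, (A (x - p) i) ^ 2 = 0
  · rw [blockCurvature, if_pos h0]
    exact ⟨le_rfl, hmM⟩
  have hpos : 0 < ∑ i ∈ S, (A (x - p) i) ^ 2 :=
    lt_of_le_of_ne (Finset.sum_nonneg fun i _ => sq_nonneg _) (Ne.symm h0)
  set l := blockCurvature m f A p S x with hl
  let w : EuclideanSpace ℝ (Fin d) := WithLp.toLp 2 fun j => if j ∈ S then A (x - p) j else 0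
  set x' := x - A.symm w with hx'
  have hw : ∀ i ∈ S, w i = A (x - p) i := fun i hi => by simp [w, hi]
  have hw' : ∀ i ∉ S, w i = 0 := fun i hi => by simp [w, hi]
  have hz' : ∀ i ∈ S, A (x' - p) i = 0 := by
    intro i hi
    rw [hx', show x - A.symm w - p = (x - p) - A.symm w by abel, map_sub,
      LinearIsometryEquiv.apply_symm_apply, PiLp.sub_apply, hw i hi, sub_self]
  have hin : inner ℝ (gradient f x - gradient f x') (x - x') =
      l * ∑ i ∈ S, (A (x - p) i) ^ 2 := by
    rw [show x - x' = A.symm w by rw [hx']; abel, ← A.inner_map_map,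
      LinearIsometryEquiv.apply_symm_apply, PiLp.inner_apply,
      ← Finset.sum_subset (Finset.subset_univ S), Finset.mul_sum]
    · refine Finset.sum_congr rfl fun i hi => ?_
      rw [hw i hi, map_sub, PiLp.sub_apply,
        gradient_eq_blockCurvature_mul (m := m) hsm.1 hf hS x hi,
        gradient_eq_blockCurvature_mul (m := m) hsm.1 hf hS x' hi, hz' i hi, ← hl]
      simp only [mul_zero, sub_zero, RCLike.inner_apply, conj_trivial]
      ring
    · intro i _ hi
      simp [hw' i hi]
  have hn : ‖x - x'‖ ^ 2 = ∑ i ∈ S, (A (x - p) i) ^ 2 := by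
    rw [show x - x' = A.symm w by rw [hx']; abel, LinearIsometryEquiv.norm_map,
      EuclideanSpace.real_norm_sq_eq, ← Finset.sum_subset (Finset.subset_univ S)]
    · exact Finset.sum_congr rfl fun i hi => by rw [hw i hi]
    · intro i _ hi
      simp [hw' i hi]
  have h1 := hsc.mul_norm_sub_sq_le hsm.1 x x'
  have h2 : inner ℝ (gradient f x - gradient f x') (x - x') ≤ M * ‖x - x'‖ ^ 2 := by
    refine (real_inner_le_norm _ _).trans ?_
    rw [sq, ← mul_assoc]
    exact mul_le_mul_of_nonneg_right (hsm.2 x x') (norm_nonneg _)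
  rw [hin, hn] at h1 h2
  exact ⟨le_of_mul_le_mul_right h1 hpos, le_of_mul_le_mul_right h2 hpos⟩

theorem IsSmoothWith.continuous_gradient (hsm : IsSmoothWith M f) : Continuous (gradient f) :=
  (LipschitzWith.of_dist_le_mul (K := M.toNNReal) fun x y => by
    rw [dist_eq_norm, dist_eq_norm]
    exact (hsm.2 x y).trans
      (mul_le_mul_of_nonneg_right (Real.le_coe_toNNReal M) (norm_nonneg _))).continuous

theorem measurable_blockCurvature (hsm : IsSmoothWith M f) (S : Finset (Fin d)) :
    Measurable (blockCurvature m f A p S) := by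
  have hg := hsm.continuous_gradient
  have c1 : Continuous fun x => ∑ i ∈ S, (A (x - p) i) ^ 2 := by fun_prop
  have c2 : Continuous fun x => ∑ i ∈ S, A (gradient f x) i * A (x - p) i := by fun_prop
  exact Measurable.ite (c1.measurable (measurableSet_singleton 0)) measurable_const
    (c2.measurable.div c1.measurable)

/-- The gradient vanishes at the minimizer, and at the center because the displacement does; strong
monotonicity allows only one critical point. -/
theorem eq_center_of_isMinimizer (hm : 0 < m) (hsc : StrongConvexOn Set.univ m f)
    (hd : Differentiable ℝ f)
    (hf : ∀ x, f x = ∑ S ∈ π.parts, h S (∑ i ∈ S, (A (x - p) i) ^ 2))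
    {xstar : EuclideanSpace ℝ (Fin d)} (hx : ∀ x, f xstar ≤ f x) : xstar = p := by
  have h1 : gradient f xstar = 0 := by
    have : IsLocalMin f xstar := Eventually.of_forall hx
    rw [gradient, this.fderiv_eq_zero, map_zero]
  have h2 : gradient f p = 0 := by
    rw [← A.map_eq_zero_iff]
    ext i
    obtain ⟨S, hS, hi⟩ := π.exists_mem (Finset.mem_univ i)
    rw [gradient_eq_blockCurvature_mul (m := m) hd hf hS p hi]
    simp
  have h3 := hsc.mul_norm_sub_sq_le hd xstar p
  rw [h1, h2, sub_self, inner_zero_left] at h3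
  have h4 : ‖xstar - p‖ ^ 2 ≤ 0 := by
    by_contra! hc
    exact absurd h3 (not_le.2 (mul_pos hm hc))
  exact sub_eq_zero.1 (norm_eq_zero.1 (pow_eq_zero_iff two_ne_zero |>.1
    (le_antisymm h4 (sq_nonneg _))))

theorem gdIterate_block (hd : Differentiable ℝ f)
    (hf : ∀ x, f x = ∑ S ∈ π.parts, h S (∑ i ∈ S, (A (x - p) i) ^ 2))
    {S : Finset (Fin d)} (hS : S ∈ π.parts) (a : ℕ → ℝ) (x₀ : EuclideanSpace ℝ (Fin d)) (n : ℕ)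
    {i : Fin d} (hi : i ∈ S) :
    A (gdIterate f a x₀ n - p) i =
      (∏ t ∈ Finset.range n, (1 - a t * blockCurvature m f A p S (gdIterate f a x₀ t))) *
        A (x₀ - p) i := by
  induction n with
  | zero => simp [gdIterate]
  | succ n ih =>
    rw [Finset.prod_range_succ, gdIterate,
      show gdIterate f a x₀ n - a n • gradient f (gdIterate f a x₀ n) - p =
        (gdIterate f a x₀ n - p) - a n • gradient f (gdIterate f a x₀ n) by abel, map_sub,
      map_smul, PiLp.sub_apply, PiLp.smul_apply,
      gradient_eq_blockCurvature_mul (m := m) hd hf hS _ hi, ih, smul_eq_mul]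
    ring

end Curvature

/-! ### Convergence under Arcsine inverse stepsizes -/

section Direct

variable {d : ℕ} {m M : ℝ} {f : EuclideanSpace ℝ (Fin d) → ℝ}
  {A : EuclideanSpace ℝ (Fin d) ≃ₗᵢ[ℝ] EuclideanSpace ℝ (Fin d)}
  {π : Finpartition (Finset.univ : Finset (Fin d))} {h : Finset (Fin d) → ℝ → ℝ}
  {p : EuclideanSpace ℝ (Fin d)}

theorem norm_le_norm_of_forall_abs_le {x y : EuclideanSpace ℝ (Fin d)}
    (hxy : ∀ i, |x i| ≤ |y i|) : ‖x‖ ≤ ‖y‖ := by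
  rw [EuclideanSpace.norm_eq, EuclideanSpace.norm_eq]
  refine Real.sqrt_le_sqrt (Finset.sum_le_sum fun i _ => ?_)
  rw [Real.norm_eq_abs, Real.norm_eq_abs]
  exact pow_le_pow_left₀ (abs_nonneg _) (hxy i) 2

/-- If every block contracts by a factor in `[c ^ n, C ^ n]`, then the contraction factor lies in
`[c, C]`. -/
theorem contractionFactor_mem_Icc (hd : Differentiable ℝ f)
    (hf : ∀ x, f x = ∑ S ∈ π.parts, h S (∑ i ∈ S, (A (x - p) i) ^ 2)) (a : ℕ → ℝ)
    {x₀ : EuclideanSpace ℝ (Fin d)} (hx₀ : x₀ ≠ p) {n : ℕ} (hn : n ≠ 0) {c C : ℝ} (hc : 0 ≤ c)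
    (hC : 0 ≤ C)
    (hQ : ∀ S ∈ π.parts, |∏ t ∈ Finset.range n,
      (1 - a t * blockCurvature m f A p S (gdIterate f a x₀ t))| ∈ Set.Icc (c ^ n) (C ^ n)) :
    contractionFactor f a x₀ p n ∈ Set.Icc c C := by
  have hpos : 0 < ‖x₀ - p‖ := norm_pos_iff.2 (sub_ne_zero.2 hx₀)
  have hQ' : ∀ i, c ^ n * |A (x₀ - p) i| ≤ |A (gdIterate f a x₀ n - p) i| ∧
      |A (gdIterate f a x₀ n - p) i| ≤ C ^ n * |A (x₀ - p) i| := by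
    intro i
    obtain ⟨S, hS, hi⟩ := π.exists_mem (Finset.mem_univ i)
    rw [gdIterate_block (m := m) hd hf hS a x₀ n hi, abs_mul]
    exact ⟨mul_le_mul_of_nonneg_right (hQ S hS).1 (abs_nonneg _),
      mul_le_mul_of_nonneg_right (hQ S hS).2 (abs_nonneg _)⟩
  have hlow : c ^ n * ‖x₀ - p‖ ≤ ‖gdIterate f a x₀ n - p‖ := by
    rw [← A.norm_map, ← A.norm_map (gdIterate f a x₀ n - p),
      ← abs_of_nonneg (pow_nonneg hc n), ← Real.norm_eq_abs, ← norm_smul]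
    refine norm_le_norm_of_forall_abs_le fun i => ?_
    rw [PiLp.smul_apply, smul_eq_mul, abs_mul, abs_of_nonneg (pow_nonneg hc n)]
    exact (hQ' i).1
  have hup : ‖gdIterate f a x₀ n - p‖ ≤ C ^ n * ‖x₀ - p‖ := by
    rw [← A.norm_map, ← A.norm_map (x₀ - p),
      ← abs_of_nonneg (pow_nonneg hC n), ← Real.norm_eq_abs, ← norm_smul]
    refine norm_le_norm_of_forall_abs_le fun i => ?_
    rw [PiLp.smul_apply, smul_eq_mul, abs_mul, abs_of_nonneg (pow_nonneg hC n)]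
    exact (hQ' i).2
  have hroot : ∀ y : ℝ, 0 ≤ y → (y ^ n) ^ (1 / (n : ℝ)) = y := fun y hy => by
    rw [one_div, Real.pow_rpow_inv_natCast hy hn]
  have hexp : (0 : ℝ) ≤ 1 / (n : ℝ) := by positivity
  constructor
  · rw [← hroot c hc]
    exact Real.rpow_le_rpow (pow_nonneg hc n) ((le_div_iff₀ hpos).2 hlow) hexp
  · conv_rhs => rw [← hroot C hC]
    exact Real.rpow_le_rpow (by positivity) ((div_le_iff₀ hpos).2 hup) hexp

/-- The iterate `n` uses only the stepsizes before time `n`; hence the curvature met at step `n` is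
independent of `β n`. -/
theorem measurable_history_gdIterate {Ω : Type*} (hsm : IsSmoothWith M f)
    (β : ℕ → Ω → ℝ)
    (x₀ : EuclideanSpace ℝ (Fin d)) (n : ℕ) :
    Measurable[history β n] fun ω => gdIterate f (fun t => (β t ω)⁻¹) x₀ n := by
  induction n with
  | zero => exact measurable_const
  | succ n ih =>
    have h1 := ih.mono (history_mono β n.le_succ) le_rfl
    have h2 : Measurable[history β (n + 1)] (β n) := measurable_history β n.lt_succ_self
    exact h1.sub (h2.inv.smul (hsm.continuous_gradient.measurable.comp h1))

variable {Ω : Type*} [mΩ : MeasurableSpace Ω] {P : Measure Ω} {β : ℕ → Ω → ℝ}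

theorem measurable_contractionFactor (hsm : IsSmoothWith M f) (hm : ∀ t, Measurable (β t))
    (x₀ xstar : EuclideanSpace ℝ (Fin d)) (n : ℕ) :
    Measurable fun ω => contractionFactor f (fun t => (β t ω)⁻¹) x₀ xstar n := by
  have := (measurable_history_gdIterate hsm β x₀ n).mono (history_le hm n) le_rfl
  exact ((this.sub_const xstar).norm.div_const _).pow_const _

theorem abs_one_sub_div_le {l b : ℝ} (hm : 0 < m) (hl : l ∈ Set.Icc m M)
    (hb : b ∈ Set.Ioo m M) : |1 - b⁻¹ * l| ≤ M / m := by
  have hb0 : 0 < b := hm.trans hb.1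
  have h1 : b⁻¹ * l ≤ M / m := by
    rw [inv_mul_eq_div]
    exact div_le_div₀ (by linarith [hb.1, hb.2]) hl.2 hm hb.1.le
  have h2 : 0 ≤ b⁻¹ * l := mul_nonneg (inv_nonneg.2 hb0.le) (hm.le.trans hl.1)
  have h3 : 1 ≤ M / m := by rw [one_le_div hm]; linarith [hl.1, hl.2]
  rw [abs_le]
  constructor <;> linarith

theorem abs_prod_eq_exp {ρ : ℝ} (hm : 0 < m) (hρ : acceleratedRate m M = ρ) {b l : ℕ → ℝ}
    (hb : ∀ t, b t ∈ Set.Ioo m M) (hne : ∀ t, b t ≠ l t) (n : ℕ) :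
    |∏ t ∈ Finset.range n, (1 - (b t)⁻¹ * l t)| =
      Real.exp (∑ t ∈ Finset.range n, logContraction m M (l t) (b t) + n * Real.log ρ) := by
  rw [Finset.abs_prod]
  have : ∀ t, |1 - (b t)⁻¹ * l t| =
      Real.exp (logContraction m M (l t) (b t) + Real.log ρ) := by
    intro t
    have hb0 : 0 < b t := hm.trans (hb t).1
    rw [logContraction, hρ, sub_add_cancel, Real.exp_log, inv_mul_eq_div]
    rw [one_sub_div hb0.ne']
    exact abs_pos.2 (div_ne_zero (sub_ne_zero.2 (hne t)) hb0.ne')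
  simp_rw [this]
  rw [← Real.exp_sum, Finset.sum_add_distrib, Finset.sum_const, Finset.card_range, nsmul_eq_mul]

/-- There are finitely many blocks, so almost surely the law of large numbers holds in all of them
at once, and every block factor is `exp (n (log ρ ± δ))` for large `n`. The crude bound `M / m`
serves as the dominating constant for `L¹`. -/
theorem ae_contractionFactor [IsProbabilityMeasure P] (h0 : 0 < m) (hmM : m < M)
    (hm : ∀ t, Measurable (β t)) (hi : iIndepFun β P)
    (hl : ∀ t, P.map (β t) = arcsineMeasure m M) {x₀ xstar : EuclideanSpace ℝ (Fin d)}
    (hI : IsInstance m M f x₀ xstar) :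
    ∀ᵐ ω ∂P,
      Tendsto (fun n => contractionFactor f (fun t => (β t ω)⁻¹) x₀ xstar n) atTop
        (𝓝 (acceleratedRate m M)) ∧
      ∀ n, contractionFactor f (fun t => (β t ω)⁻¹) x₀ xstar n ∈ Set.Icc 0 (M / m) := by
  have := isProbabilityMeasure_arcsineMeasure hmM
  obtain ⟨A, π, h, p, hf⟩ := hI.radiallySeparable.exists_normalForm
  obtain rfl := eq_center_of_isMinimizer h0 hI.stronglyConvex hI.smooth.1 hf hI.isMinimizer
  have hd := hI.smooth.1
  have hρ := acceleratedRate_pos h0 hmM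
  set ρ := acceleratedRate m M with hρdef
  set L : Finset (Fin d) → ℕ → Ω → ℝ := fun S t ω =>
    blockCurvature m f A xstar S (gdIterate f (fun t => (β t ω)⁻¹) x₀ t)
  have hLm : ∀ S t, Measurable[history β t] (L S t) := fun S t =>
    (measurable_blockCurvature hI.smooth S).comp (measurable_history_gdIterate hI.smooth β x₀ t)
  have hLI : ∀ S ∈ π.parts, ∀ t ω, L S t ω ∈ Set.Icc m M := fun S hS t ω =>
    blockCurvature_mem_Icc hmM.le hI.stronglyConvex hI.smooth hf hS _
  have hβ : ∀ᵐ ω ∂P, ∀ t, β t ω ∈ Set.Ioo m M := by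
    rw [ae_all_iff]
    intro t
    refine ae_of_ae_map (hm t).aemeasurable ?_
    rw [hl]
    exact arcsineMeasure_ae_mem_Ioo m M
  have hne : ∀ᵐ ω ∂P, ∀ S ∈ π.parts, ∀ t, β t ω ≠ L S t ω :=
    (Finset.eventually_all _).2 fun S _ => ae_forall_ne_of_history hm hi hl (hLm S)
  have hlln : ∀ᵐ ω ∂P, ∀ S ∈ π.parts, ∀ δ > 0, ∀ᶠ n : ℕ in atTop,
      |∑ i ∈ Finset.range n, logContraction m M (L S i ω) (β i ω)| ≤ n * δ :=
    (Finset.eventually_all _).2 fun S hS =>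
      ae_forall_eventually_abs_sum_logContraction_le h0 hmM hm hi hl (hLm S) (hLI S hS)
  filter_upwards [hβ, hne, hlln] with ω hβ hne hlln
  constructor
  · have key : ∀ δ > 0, ∀ᶠ n in atTop, contractionFactor f (fun t => (β t ω)⁻¹) x₀ xstar n ∈
        Set.Icc (Real.exp (Real.log ρ - δ)) (Real.exp (Real.log ρ + δ)) := by
      intro δ hδ
      have := (Finset.eventually_all _).2 fun S hS => hlln S hS δ hδ
      filter_upwards [this, eventually_ne_atTop 0] with n hn hn0
      refine contractionFactor_mem_Icc (m := m) hd hf _ hI.init_ne hn0 (Real.exp_pos _).le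
        (Real.exp_pos _).le fun S hS => ?_
      have e := abs_prod_eq_exp (l := fun t => L S t ω) h0 hρdef.symm hβ (hne S hS) n
      simp only [L] at e
      rw [e, ← Real.exp_nat_mul, ← Real.exp_nat_mul]
      have := abs_le.1 (hn S hS)
      simp only [L] at this
      constructor <;> rw [Real.exp_le_exp] <;> nlinarith
    have c1 : Tendsto (fun δ => Real.exp (Real.log ρ - δ)) (𝓝[>] 0) (𝓝 ρ) := by
      have : Continuous fun δ => Real.exp (Real.log ρ - δ) := by fun_prop
      simpa [Real.exp_log hρ] using (this.tendsto 0).mono_left nhdsWithin_le_nhds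
    have c2 : Tendsto (fun δ => Real.exp (Real.log ρ + δ)) (𝓝[>] 0) (𝓝 ρ) := by
      have : Continuous fun δ => Real.exp (Real.log ρ + δ) := by fun_prop
      simpa [Real.exp_log hρ] using (this.tendsto 0).mono_left nhdsWithin_le_nhds
    rw [tendsto_order]
    constructor
    · intro r hr
      obtain ⟨δ, h1, h2⟩ := ((c1.eventually_const_lt hr).and self_mem_nhdsWithin).exists
      filter_upwards [key δ h2] with n hn using h1.trans_le hn.1
    · intro r hr
      obtain ⟨δ, h1, h2⟩ := ((c2.eventually_lt_const hr).and self_mem_nhdsWithin).exists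
      filter_upwards [key δ h2] with n hn using hn.2.trans_lt h1
  · intro n
    have hκ : 1 ≤ M / m := by rw [one_le_div h0]; exact hmM.le
    rcases eq_or_ne n 0 with rfl | hn
    -- At `n = 0` the exponent `1 / 0` is `0` and the factor is `1`.
    · simp [contractionFactor, hκ]
    · refine contractionFactor_mem_Icc (m := m) hd hf _ hI.init_ne hn le_rfl
        (zero_le_one.trans hκ) fun S hS => ⟨?_, ?_⟩
      · rw [zero_pow hn]; exact abs_nonneg _
      · rw [Finset.abs_prod]
        refine (Finset.prod_le_prod (fun _ _ => abs_nonneg _) fun t _ =>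
          abs_one_sub_div_le h0 (hLI S hS t ω) (hβ t)).trans ?_
        rw [Finset.prod_const, Finset.card_range]

theorem convergesInL1_of_ae_bounded [IsProbabilityMeasure P] {R : ℕ → Ω → ℝ} {ρ C : ℝ}
    (hR : ∀ n, AEStronglyMeasurable (R n) P)
    (ht : ∀ᵐ ω ∂P, Tendsto (fun n => R n ω) atTop (𝓝 ρ))
    (hC : ∀ᵐ ω ∂P, ∀ n, |R n ω| ≤ C) : ConvergesInL1 P R ρ := by
  refine ⟨fun n => MemLp.of_bound (hR n) C ?_, ?_⟩
  · filter_upwards [hC] with ω hω using hω n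
  · simp_rw [eLpNorm_one_eq_lintegral_enorm]
    have h0 : ∫⁻ _ : Ω, (0 : ℝ≥0∞) ∂P = 0 := lintegral_zero
    rw [← h0]
    refine tendsto_lintegral_of_dominated_convergence' (fun _ => ENNReal.ofReal (C + |ρ|))
      (fun n => ((hR n).sub aestronglyMeasurable_const).enorm) (fun n => ?_) (by simp) ?_
    · filter_upwards [hC] with ω hω
      rw [Real.enorm_eq_ofReal_abs]
      exact ENNReal.ofReal_le_ofReal ((abs_sub _ _).trans (by linarith [hω n]))
    · filter_upwards [ht] with ω hω
      have : Tendsto (fun n => R n ω - ρ) atTop (𝓝 0) := by simpa using hω.sub_const ρ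
      simpa using this.enorm

/-- An i.i.d. sequence of inverse stepsizes has a measurable modification. -/
theorem IsIIDInverseStepsizes.exists_measurable {α : ℕ → Ω → ℝ} {μ : Measure ℝ}
    (hα : IsIIDInverseStepsizes P α μ) :
    ∃ β : ℕ → Ω → ℝ, (∀ t, Measurable (β t)) ∧ iIndepFun β P ∧ (∀ t, P.map (β t) = μ) ∧
      ∀ᵐ ω ∂P, (fun t => α t ω) = fun t => (β t ω)⁻¹ := by
  have hae := fun t => (hα.law t).aemeasurable.ae_eq_mk
  refine ⟨fun t => (hα.law t).aemeasurable.mk _, fun t => (hα.law t).aemeasurable.measurable_mk,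
    hα.indep.congr hae, fun t => ?_, ?_⟩
  · rw [← Measure.map_congr (hae t), (hα.law t).map_eq]
  · filter_upwards [ae_all_iff.2 hae] with ω hω
    ext t
    rw [← hω t, inv_inv]

theorem convergence_of_arcsine [IsProbabilityMeasure P] (h0 : 0 < m) (hmM : m < M)
    {α : ℕ → Ω → ℝ} (hα : IsIIDInverseStepsizes P α (arcsineMeasure m M))
    {x₀ xstar : EuclideanSpace ℝ (Fin d)} (hI : IsInstance m M f x₀ xstar) :
    ConvergesAlmostSurely P
      (fun n ω => contractionFactor f (fun t => α t ω) x₀ xstar n) (acceleratedRate m M) ∧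
    ConvergesInL1 P
      (fun n ω => contractionFactor f (fun t => α t ω) x₀ xstar n) (acceleratedRate m M) := by
  obtain ⟨β, hm, hi, hl, hae⟩ := hα.exists_measurable
  have key := ae_contractionFactor h0 hmM hm hi hl hI
  have h1 : ∀ᵐ ω ∂P, Tendsto (fun n => contractionFactor f (fun t => α t ω) x₀ xstar n) atTop
      (𝓝 (acceleratedRate m M)) := by
    filter_upwards [key, hae] with ω h1 h2
    rw [h2]
    exact h1.1
  refine ⟨h1, convergesInL1_of_ae_bounded (C := M / m) (fun n => ?_) h1 ?_⟩
  · refine (measurable_contractionFactor hI.smooth hm x₀ xstar n).aestronglyMeasurable.congr ?_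
    filter_upwards [hae] with ω h2
    rw [h2]
  · filter_upwards [key, hae] with ω h1 h2 n
    rw [h2, abs_of_nonneg (h1.2 n).1]
    exact (h1.2 n).2

end Direct

/-! ### Isotropic quadratics as test functions -/

section Quadratic

variable {d : ℕ}

theorem hasGradientAt_half_mul_norm_sq (l : ℝ) (x : EuclideanSpace ℝ (Fin d)) :
    HasGradientAt (fun x : EuclideanSpace ℝ (Fin d) => l / 2 * ‖x‖ ^ 2) (l • x) x := by
  rw [hasGradientAt_iff_hasFDerivAt]
  refine ((hasStrictFDerivAt_norm_sq x).hasFDerivAt.const_mul (l / 2)).congr_fderiv ?_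
  ext y
  simp
  ring

theorem gradient_half_mul_norm_sq (l : ℝ) (x : EuclideanSpace ℝ (Fin d)) :
    gradient (fun x : EuclideanSpace ℝ (Fin d) => l / 2 * ‖x‖ ^ 2) x = l • x :=
  (hasGradientAt_half_mul_norm_sq l x).gradient

theorem isInstance_half_mul_norm_sq (hd : 0 < d) {m M l : ℝ} (hm : 0 < m)
    (hl : l ∈ Set.Icc m M) {x₀ : EuclideanSpace ℝ (Fin d)} (hx₀ : x₀ ≠ 0) :
    IsInstance m M (fun x : EuclideanSpace ℝ (Fin d) => l / 2 * ‖x‖ ^ 2) x₀ 0 where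
  radiallySeparable := by
    have : NeZero d := ⟨hd.ne'⟩
    refine ⟨1, one_mem _, Finpartition.indiscrete (Finset.univ_nonempty (α := Fin d)).ne_empty,
      fun S x => l / 2 * ‖x‖ ^ 2,
      fun S _ => ⟨fun t => l / 2 * t ^ 2, 0, fun x => by rw [sub_zero]⟩, fun x => ?_⟩
    rw [Finpartition.indiscrete_parts, Finset.sum_singleton]
    beta_reduce
    rw [EuclideanSpace.real_norm_sq_eq,
      EuclideanSpace.real_norm_sq_eq]
    congr 1
    rw [Finset.sum_coe_sort Finset.univ
      (fun i => (blockCoords 1 Finset.univ x).ofLp ⟨i, Finset.mem_univ i⟩ ^ 2)]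
    simp [blockCoords]
  stronglyConvex := by
    rw [strongConvexOn_iff_convex]
    have h1 : ConvexOn ℝ Set.univ fun x : EuclideanSpace ℝ (Fin d) => ‖x‖ ^ 2 :=
      (convexOn_norm convex_univ).pow (fun _ _ => norm_nonneg _) 2
    have h2 := h1.smul (show 0 ≤ (l - m) / 2 by linarith [hl.1])
    refine h2.congr fun x _ => ?_
    simp only [smul_eq_mul]
    ring
  smooth := by
    refine ⟨fun x => (hasGradientAt_half_mul_norm_sq l x).differentiableAt, fun x y => ?_⟩
    rw [gradient_half_mul_norm_sq, gradient_half_mul_norm_sq, ← smul_sub, norm_smul,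
      Real.norm_eq_abs, abs_of_pos (hm.trans_le hl.1)]
    exact mul_le_mul_of_nonneg_right hl.2 (norm_nonneg _)
  isMinimizer := fun x => by
    have := hm.trans_le hl.1
    simp only [norm_zero]
    have := this.le
    rw [zero_pow two_ne_zero, mul_zero]
    exact mul_nonneg (by linarith) (sq_nonneg _)
  init_ne := hx₀

theorem contractionFactor_half_mul_norm_sq (l : ℝ) (a : ℕ → ℝ)
    {x₀ : EuclideanSpace ℝ (Fin d)} (hx₀ : x₀ ≠ 0) (n : ℕ) :
    contractionFactor (fun x : EuclideanSpace ℝ (Fin d) => l / 2 * ‖x‖ ^ 2) a x₀ 0 n =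
      (∏ t ∈ Finset.range n, |1 - l * a t|) ^ (1 / (n : ℝ)) := by
  have h : gdIterate (fun x : EuclideanSpace ℝ (Fin d) => l / 2 * ‖x‖ ^ 2) a x₀ n =
      (∏ t ∈ Finset.range n, (1 - l * a t)) • x₀ := by
    induction n with
    | zero => simp [gdIterate]
    | succ n ih =>
      rw [gdIterate, ih, gradient_half_mul_norm_sq, smul_smul, smul_smul, ← sub_smul,
        Finset.prod_range_succ]
      congr 1
      ring
  rw [contractionFactor, h, sub_zero, sub_zero, norm_smul, mul_div_assoc,
    div_self (norm_ne_zero_iff.2 hx₀), mul_one, Real.norm_eq_abs, Finset.abs_prod]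

end Quadratic

/-! ### From the assumed rate to a bound on the expected log contraction -/

/-- Each event `{∀ n ≥ N, r ≤ R n}` lies in `{r ≤ R n}` for all large `n`, so it is null, while the
union over `N` has full measure. Only monotonicity and null sets enter, so `R` need not be
measurable. -/
theorem not_asymptoticallyAtMost_of_ae_eventually_le {Ω : Type*} [MeasurableSpace Ω]
    {P : Measure Ω} [IsProbabilityMeasure P] {R : ℕ → Ω → ℝ} {ρ r : ℝ} (hr : ρ < r)
    (hR : ∀ᵐ ω ∂P, ∀ᶠ n in atTop, r ≤ R n ω) : ¬ AsymptoticallyAtMost P R ρ := by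
  intro h
  have ht := h (r - ρ) (sub_pos.2 hr)
  simp only [add_sub_cancel] at ht
  have h0 : ∀ N, P {ω | ∀ n ≥ N, r ≤ R n ω} = 0 := by
    intro N
    refine le_antisymm (ge_of_tendsto ht ?_) (zero_le)
    filter_upwards [eventually_ge_atTop N] with n hn
    exact measure_mono fun ω hω => hω n hn
  have h1 : ∀ᵐ ω ∂P, ω ∉ ⋃ N, {ω | ∀ n ≥ N, r ≤ R n ω} :=
    measure_eq_zero_iff_ae_notMem.1 (measure_iUnion_null h0)
  have h2 : ∀ᵐ _ω ∂P, False := by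
    filter_upwards [h1, hR] with ω h1 h2
    obtain ⟨N, hN⟩ := eventually_atTop.1 h2
    exact h1 (Set.mem_iUnion.2 ⟨N, hN⟩)
  exact h2.exists.choose_spec

/-- If gradient descent on the quadratic of curvature `l` has asymptotic rate at most `ρ`, then the
expected log contraction at `l`, and any minorant of it, is at most `log ρ`. -/
theorem integral_le_log_of_asymptoticallyAtMost {d : ℕ} {Ω : Type*} [MeasurableSpace Ω]
    {P : Measure Ω} [IsProbabilityMeasure P] {α : ℕ → Ω → ℝ} {μ : Measure ℝ}
    (hα : IsIIDInverseStepsizes P α μ) {l ρ : ℝ} (hρ : 0 < ρ)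
    {x₀ : EuclideanSpace ℝ (Fin d)} (hx₀ : x₀ ≠ 0)
    (hR : AsymptoticallyAtMost P (fun n ω => contractionFactor
      (fun x : EuclideanSpace ℝ (Fin d) => l / 2 * ‖x‖ ^ 2) (fun t => α t ω) x₀ 0 n) ρ)
    (hatom : μ {l} = 0) {Y : ℝ → ℝ} (hYm : Measurable Y) (hYi : Integrable Y μ)
    (hY : ∀ b, Y b ≤ Real.log |1 - l / b|) : ∫ b, Y b ∂μ ≤ Real.log ρ := by
  -- For `c` strictly between `log ρ` and `∫ Y`, the strong law for `Y (β t)` makes the contraction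
  -- factor eventually at least `exp c > ρ`.
  by_contra! hlt
  obtain ⟨c, hc1, hc2⟩ := exists_between hlt
  obtain ⟨β, hm, hi, hlaw, hae⟩ := hα.exists_measurable
  have hr : ρ < Real.exp c := by rwa [← Real.log_lt_iff_lt_exp hρ]
  refine not_asymptoticallyAtMost_of_ae_eventually_le hr ?_ hR
  have hint : Integrable (fun ω => Y (β 0 ω)) P := by
    rw [← hlaw 0] at hYi
    exact (integrable_map_measure hYm.aestronglyMeasurable (hm 0).aemeasurable).1 hYi
  have hE : ∫ ω, Y (β 0 ω) ∂P = ∫ b, Y b ∂μ := by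
    rw [← hlaw 0, integral_map (hm 0).aemeasurable hYm.aestronglyMeasurable]
  have hslln := strong_law_ae_real (fun t ω => Y (β t ω)) hint
    (fun i j hij => (hi.indepFun hij).comp hYm hYm) fun i =>
      (IdentDistrib.mk (hm i).aemeasurable (hm 0).aemeasurable (by rw [hlaw, hlaw])).comp hYm
  -- At `β t = l` the factor is `0` but `Real.log 0 = 0`, and `hY` would not bound the factor from
  -- below; this is where `hatom` is needed.
  have hne : ∀ᵐ ω ∂P, ∀ t, β t ω ≠ l := by
    rw [ae_all_iff]
    intro t
    refine ae_of_ae_map (p := fun b => b ≠ l) (hm t).aemeasurable ?_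
    rw [hlaw, ae_iff]
    simpa using hatom
  filter_upwards [hslln, hne, hae] with ω h1 h2 h3
  rw [hE] at h1
  filter_upwards [h1.eventually_const_lt hc2, eventually_gt_atTop 0] with n hn hn0
  have hn0' : (0 : ℝ) < n := by exact_mod_cast hn0
  rw [h3, contractionFactor_half_mul_norm_sq l _ hx₀]
  have hfac : ∀ t, Real.exp (Y (β t ω)) ≤ |1 - l * (β t ω)⁻¹| := by
    intro t
    have hpos : 0 < |1 - l * (β t ω)⁻¹| := by
      rw [abs_pos, sub_ne_zero]
      intro hh
      have hb : β t ω ≠ 0 := fun hb => by simp [hb] at hh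
      exact h2 t (by field_simp at hh; exact hh)
    rw [← Real.le_log_iff_exp_le hpos]
    exact hY _
  have hprod : Real.exp c ^ n ≤ ∏ t ∈ Finset.range n, |1 - l * (β t ω)⁻¹| := by
    refine le_trans ?_ (Finset.prod_le_prod (fun _ _ => (Real.exp_pos _).le) fun t _ => hfac t)
    rw [← Real.exp_sum, ← Real.exp_nat_mul, Real.exp_le_exp]
    rw [lt_div_iff₀ hn0'] at hn
    linarith
  calc Real.exp c = (Real.exp c ^ n) ^ (1 / (n : ℝ)) := by
        rw [one_div, Real.pow_rpow_inv_natCast (Real.exp_pos _).le hn0.ne']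
    _ ≤ _ := Real.rpow_le_rpow (by positivity) hprod (by positivity)

theorem lintegral_ofReal_const_sub {X : Type*} [MeasurableSpace X] {ν : Measure X}
    [IsProbabilityMeasure ν] {K : ℝ} {g : X → ℝ} (hg : Integrable g ν) (hK : ∀ᵐ x ∂ν, g x ≤ K) :
    ∫⁻ x, ENNReal.ofReal (K - g x) ∂ν = ENNReal.ofReal (K - ∫ x, g x ∂ν) := by
  have hi : Integrable (fun x => K - g x) ν := (integrable_const K).sub hg
  rw [← ofReal_integral_eq_lintegral_ofReal hi (hK.mono fun x hx => sub_nonneg.2 hx),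
    integral_sub (integrable_const _) hg]
  simp

theorem acceleratedRate_inv {m M : ℝ} (hm : 0 < m) (hM : 0 < M) :
    acceleratedRate M⁻¹ m⁻¹ = acceleratedRate m M := by
  have : m⁻¹ / M⁻¹ = M / m := by field_simp
  rw [acceleratedRate, acceleratedRate, this]

/-- Since `1 - x / u = (u - x) / u`, the integral is the potential at `x` minus that at `0`, and the
potential is minimal exactly on `[a, c]`. -/
theorem log_abs_one_sub_inv_mul_arcsineMeasure {a c : ℝ} (ha : 0 < a) (hac : a < c) (x : ℝ) :
    Integrable (fun u => Real.log |1 - u⁻¹ * x|) (arcsineMeasure a c) ∧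
      Real.log (acceleratedRate a c) ≤ ∫ u, Real.log |1 - u⁻¹ * x| ∂arcsineMeasure a c ∧
      (x ∈ Set.Icc a c ↔
        ∫ u, Real.log |1 - u⁻¹ * x| ∂arcsineMeasure a c = Real.log (acceleratedRate a c)) := by
  have i1 := integrable_log_abs_sub_arcsineMeasure hac x
  obtain ⟨i2, e2⟩ := integral_log_arcsineMeasure ha hac
  have hae : (fun u => Real.log |u - x| - Real.log u) =ᵐ[arcsineMeasure a c]
      fun u => Real.log |1 - u⁻¹ * x| := by
    filter_upwards [arcsineMeasure_ae_mem_Ioo a c, Measure.ae_ne (arcsineMeasure a c) x]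
      with u hu hne
    have hu0 : 0 < u := ha.trans hu.1
    rw [inv_mul_eq_div, one_sub_div hu0.ne', abs_div,
      Real.log_div (abs_ne_zero.2 (sub_ne_zero.2 hne)) (abs_ne_zero.2 hu0.ne'), Real.log_abs u]
  have hle := log_le_integral_log_arcsineMeasure hac x
  rw [← integral_congr_ae hae, integral_sub i1 i2, e2, log_acceleratedRate ha hac]
  refine ⟨(i1.sub i2).congr hae, by linarith, fun hx => ?_, fun hx => ?_⟩
  · rw [(arcsineMeasure_log_of_mem hac hx).2]
  · exact mem_Icc_of_integral_log_arcsineMeasure_le hac (by linarith)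

/-- A bound for the log contraction at curvatures in `[m, M]` and stepsizes of size at most
`2 / m`. -/
noncomputable def logCap (m M : ℝ) : ℝ := Real.log (1 + 2 * (M / m))

/-! ### Averaging over curvatures forces equality -/

section Converse

variable {m M : ℝ}

theorem logCap_pos (hm : 0 < m) (hmM : m < M) : 0 < logCap m M := by
  have : 0 < M / m := div_pos (hm.trans hmM) hm
  exact Real.log_pos (by linarith)

theorem log_acceleratedRate_neg (hm : 0 < m) (hmM : m < M) :
    Real.log (acceleratedRate m M) < 0 :=
  Real.log_neg (acceleratedRate_pos hm hmM) acceleratedRate_lt_one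

theorem log_abs_one_sub_mul_le_logCap (hm : 0 < m) {l x : ℝ} (hl : l ∈ Set.Icc m M)
    (hx : |x| ≤ 2 / m) : Real.log |1 - l * x| ≤ logCap m M := by
  have hM : 0 < M := hm.trans_le (hl.1.trans hl.2)
  have hκ : 0 < M / m := div_pos hM hm
  rcases eq_or_ne (1 - l * x) 0 with h | h
  · rw [h, abs_zero, Real.log_zero]
    exact Real.log_nonneg (by linarith)
  · refine Real.log_le_log (abs_pos.2 h) ((abs_sub _ _).trans ?_)
    rw [abs_one, abs_mul, abs_of_pos (hm.trans_le hl.1)]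
    have : l * |x| ≤ M * (2 / m) := mul_le_mul hl.2 hx (abs_nonneg _) hM.le
    have e : M * (2 / m) = 2 * (M / m) := by ring
    linarith

theorem abs_inv_le_of_mem_Icc (hm : 0 < m) {b : ℝ} (hb : b ∈ Set.Icc m M) : |b⁻¹| ≤ 2 / m := by
  have hb0 : 0 < b := hm.trans_le hb.1
  rw [abs_of_pos (inv_pos.2 hb0), inv_eq_one_div]
  exact div_le_div₀ zero_le_two one_le_two hm hb.1

theorem inv_mem_Icc_iff (hm : 0 < m) (hM : 0 < M) {b : ℝ} :
    b⁻¹ ∈ Set.Icc M⁻¹ m⁻¹ ↔ b ∈ Set.Icc m M := by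
  constructor
  · rintro ⟨h1, h2⟩
    have hb : 0 < b := inv_pos.1 ((inv_pos.2 hM).trans_le h1)
    exact ⟨(inv_le_inv₀ hb hm).1 h2, (inv_le_inv₀ hM hb).1 h1⟩
  · rintro ⟨h1, h2⟩
    have hb : 0 < b := hm.trans_le h1
    exact ⟨(inv_le_inv₀ hM hb).2 h2, (inv_le_inv₀ hb hm).2 h1⟩

theorem inv_mem_Ioo (hm : 0 < m) (hM : 0 < M) {u : ℝ} (hu : u ∈ Set.Ioo M⁻¹ m⁻¹) :
    u⁻¹ ∈ Set.Ioo m M := by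
  have hu0 : 0 < u := (inv_pos.2 hM).trans hu.1
  exact ⟨(lt_inv_comm₀ hu0 hm).1 hu.2, (inv_lt_comm₀ hM hu0).1 hu.1⟩

/-- Averaged over the curvature, the truncated log contraction at any stepsize is at least the
accelerated rate, with equality only at inverse stepsizes in `[m, M]`. -/
theorem lintegral_logCap_sub_le (hm : 0 < m) (hmM : m < M) (b : ℝ) :
    ∫⁻ u, ENNReal.ofReal (logCap m M - min (Real.log |1 - u⁻¹ / b|) (logCap m M))
        ∂arcsineMeasure M⁻¹ m⁻¹ ≤
      ENNReal.ofReal (logCap m M - Real.log (acceleratedRate m M)) ∧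
    (∫⁻ u, ENNReal.ofReal (logCap m M - min (Real.log |1 - u⁻¹ / b|) (logCap m M))
        ∂arcsineMeasure M⁻¹ m⁻¹ =
      ENNReal.ofReal (logCap m M - Real.log (acceleratedRate m M)) → b ∈ Set.Icc m M) := by
  have hM : 0 < M := hm.trans hmM
  have hMm : M⁻¹ < m⁻¹ := (inv_lt_inv₀ hM hm).2 hmM
  have := isProbabilityMeasure_arcsineMeasure hMm
  have hK := logCap_pos hm hmM
  have hρ := log_acceleratedRate_neg hm hmM
  simp only [div_eq_mul_inv]
  -- For `|b⁻¹| ≤ 2 / m` the truncation is inactive and the potential decides. Otherwise `|1 - l /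
  -- b| ≥ l * |b⁻¹| - 1 ≥ 1`, so the truncated logarithm is nonnegative, strictly above `log ρ < 0`.
  by_cases hb : |b⁻¹| ≤ 2 / m
  · obtain ⟨i, hle, hiff⟩ := log_abs_one_sub_inv_mul_arcsineMeasure (inv_pos.2 hM) hMm b⁻¹
    rw [acceleratedRate_inv hm hM] at hle hiff
    have hcap : ∀ᵐ u ∂arcsineMeasure M⁻¹ m⁻¹, Real.log |1 - u⁻¹ * b⁻¹| ≤ logCap m M := by
      filter_upwards [arcsineMeasure_ae_mem_Ioo M⁻¹ m⁻¹] with u hu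
      exact log_abs_one_sub_mul_le_logCap hm (Set.Ioo_subset_Icc_self (inv_mem_Ioo hm hM hu)) hb
    have e : ∫⁻ u, ENNReal.ofReal (logCap m M - min (Real.log |1 - u⁻¹ * b⁻¹|) (logCap m M))
        ∂arcsineMeasure M⁻¹ m⁻¹ = ENNReal.ofReal (logCap m M -
          ∫ u, Real.log |1 - u⁻¹ * b⁻¹| ∂arcsineMeasure M⁻¹ m⁻¹) := by
      rw [lintegral_congr_ae (g := fun u => ENNReal.ofReal
        (logCap m M - Real.log |1 - u⁻¹ * b⁻¹|)) (hcap.mono fun u hu => by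
          simp only [min_eq_left hu]), lintegral_ofReal_const_sub i hcap]
    rw [e]
    refine ⟨ENNReal.ofReal_le_ofReal (by linarith), fun heq => ?_⟩
    rw [← inv_mem_Icc_iff hm hM, hiff]
    have : logCap m M - Real.log (acceleratedRate m M) ≤ logCap m M -
        ∫ u, Real.log |1 - u⁻¹ * b⁻¹| ∂arcsineMeasure M⁻¹ m⁻¹ :=
      (ENNReal.ofReal_le_ofReal_iff' .. |>.1 heq.ge).resolve_right (by linarith)
    linarith
  · push Not at hb
    have hle : ∫⁻ u, ENNReal.ofReal (logCap m M - min (Real.log |1 - u⁻¹ * b⁻¹|) (logCap m M))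
        ∂arcsineMeasure M⁻¹ m⁻¹ ≤ ENNReal.ofReal (logCap m M) := by
      calc _ ≤ ∫⁻ _, ENNReal.ofReal (logCap m M) ∂arcsineMeasure M⁻¹ m⁻¹ := by
            refine lintegral_mono_ae ?_
            filter_upwards [arcsineMeasure_ae_mem_Ioo M⁻¹ m⁻¹] with u hu
            refine ENNReal.ofReal_le_ofReal ?_
            have hl := inv_mem_Ioo hm hM hu
            have h0 : 0 ≤ Real.log |1 - u⁻¹ * b⁻¹| := by
              refine Real.log_nonneg ?_
              have h1 : |u⁻¹ * b⁻¹| - |1| ≤ |u⁻¹ * b⁻¹ - 1| := abs_sub_abs_le_abs_sub _ _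
              have h2 : m * (2 / m) ≤ u⁻¹ * |b⁻¹| :=
                mul_le_mul hl.1.le hb.le (by positivity) (hm.trans hl.1).le
              rw [mul_div_cancel₀ _ hm.ne'] at h2
              rw [abs_mul, abs_of_pos (hm.trans hl.1), abs_one] at h1
              rw [abs_sub_comm]
              linarith
            have := le_min h0 hK.le
            linarith
        _ = _ := by simp
    have hlt : ENNReal.ofReal (logCap m M) <
        ENNReal.ofReal (logCap m M - Real.log (acceleratedRate m M)) :=
      (ENNReal.ofReal_lt_ofReal_iff (by linarith)).2 (by linarith)
    exact ⟨hle.trans hlt.le, fun heq => absurd (hle.trans_lt hlt) heq.not_lt⟩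

/-- `μ` is supported in `[m, M]` and equalizes the expected log contraction over almost all
curvatures in `(m, M)`. -/
def IsEqualizing (m M : ℝ) (μ : Measure ℝ) : Prop :=
  (∀ᵐ b ∂μ, b ∈ Set.Icc m M) ∧ ∀ᵐ l, l ∈ Set.Ioo m M →
    ∫⁻ b, ENNReal.ofReal (logCap m M - Real.log |1 - l / b|) ∂μ =
      ENNReal.ofReal (logCap m M - Real.log (acceleratedRate m M))

theorem isEqualizing_arcsineMeasure (hm : 0 < m) (hmM : m < M) :
    IsEqualizing m M (arcsineMeasure m M) := by
  have := isProbabilityMeasure_arcsineMeasure hmM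
  have hmem : ∀ᵐ b ∂arcsineMeasure m M, b ∈ Set.Icc m M :=
    (arcsineMeasure_ae_mem_Ioo m M).mono fun b hb => Set.Ioo_subset_Icc_self hb
  refine ⟨hmem, ae_of_all _ fun l hl => ?_⟩
  obtain ⟨i, e⟩ := integral_log_one_sub_div_arcsineMeasure hm hmM (Set.Ioo_subset_Icc_self hl)
  rw [lintegral_ofReal_const_sub i, e]
  filter_upwards [hmem] with b hb
  rw [div_eq_mul_inv]
  exact log_abs_one_sub_mul_le_logCap hm (Set.Ioo_subset_Icc_self hl)
    (abs_inv_le_of_mem_Icc hm hb)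

/-- The inverse map `l ↦ (l - w)⁻¹` is differentiable away from `w`, hence sends null sets to null
sets. -/
theorem ae_add_inv {Q : ℝ → Prop} (hQ : ∀ᵐ l, Q l) (w : ℝ) :
    ∀ᵐ u : ℝ, u ≠ 0 → Q (w + u⁻¹) := by
  set N : Set ℝ := {l | l - w ≠ 0 ∧ ¬ Q l}
  have hN : volume N = 0 := measure_mono_null (fun l hl => hl.2) (ae_iff.1 hQ)
  have him : volume ((fun l => (l - w)⁻¹) '' N) = 0 := by
    refine addHaar_image_eq_zero_of_differentiableOn_of_addHaar_eq_zero volume ?_ hN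
    intro l hl
    exact ((differentiableAt_id.sub_const w).inv hl.1).differentiableWithinAt
  refine ae_iff.2 (measure_mono_null ?_ him)
  intro u hu
  simp only [Set.mem_ofPred_eq, not_forall] at hu
  obtain ⟨hu0, hu1⟩ := hu
  exact ⟨w + u⁻¹, ⟨by simpa using hu0, hu1⟩, by simp⟩

theorem ae_of_ae_arcsineMeasure {a b : ℝ} {Q : ℝ → Prop}
    (hQ : ∀ᵐ u ∂arcsineMeasure a b, Q u) : ∀ᵐ u : ℝ, u ∈ Set.Ioo a b → Q u := by
  have hmd : Measurable fun t => ENNReal.ofReal ((Set.Ioo a b).indicator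
      (fun β => 1 / (Real.pi * √((b - β) * (β - a)))) t) :=
    (Measurable.indicator (by fun_prop) measurableSet_Ioo).ennreal_ofReal
  rw [arcsineMeasure, ae_withDensity_iff hmd] at hQ
  filter_upwards [hQ] with u hu hmem
  refine hu ?_
  rw [Set.indicator_of_mem hmem, Ne, ENNReal.ofReal_eq_zero, not_le]
  have h1 : 0 < b - u := by linarith [hmem.2]
  have h2 : 0 < u - a := by linarith [hmem.1]
  have := Real.pi_pos
  positivity

/-- A minimax argument on `H = K - min (log |1 - u⁻¹ / b|) K ≥ 0`: its average over `u` is at most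
`C` for every `b`, its average over `b` is at least `C` for almost every `u`. By Tonelli the two
double integrals agree, so both inequalities are equalities almost everywhere. -/
theorem isEqualizing_of_forall_integral_le (hm : 0 < m) (hmM : m < M) {μ : Measure ℝ}
    [IsProbabilityMeasure μ]
    (hμ : ∀ l ∈ Set.Icc m M, μ {l} = 0 →
      Integrable (fun b => min (Real.log |1 - l / b|) (logCap m M)) μ →
      ∫ b, min (Real.log |1 - l / b|) (logCap m M) ∂μ ≤ Real.log (acceleratedRate m M)) :
    IsEqualizing m M μ := by
  have hM : 0 < M := hm.trans hmM
  have hMm : M⁻¹ < m⁻¹ := (inv_lt_inv₀ hM hm).2 hmM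
  have := isProbabilityMeasure_arcsineMeasure hMm
  set σ := arcsineMeasure M⁻¹ m⁻¹ with hσ
  set K := logCap m M with hK
  set C : ℝ≥0∞ := ENNReal.ofReal (K - Real.log (acceleratedRate m M)) with hC
  have hCtop : C ≠ ⊤ := ENNReal.ofReal_ne_top
  set H : ℝ → ℝ → ℝ≥0∞ := fun u b =>
    ENNReal.ofReal (K - min (Real.log |1 - u⁻¹ / b|) K) with hH
  have hHm : Measurable (Function.uncurry H) := by
    unfold Function.uncurry; simp only [hH]; fun_prop
  have hb : ∀ b, ∫⁻ u, H u b ∂σ ≤ C := fun b => (lintegral_logCap_sub_le hm hmM b).1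
  -- `μ` has at most countably many atoms and `σ` has none.
  have hatom : ∀ᵐ u ∂σ, μ {u⁻¹} = 0 := by
    have hc : {t : ℝ | 0 < μ {a : ℝ | a = t}}.Countable :=
      Measure.countable_meas_level_set_pos (g := id) measurable_id
    filter_upwards [(hc.image Inv.inv).ae_notMem σ] with u hu
    by_contra hne
    exact hu ⟨u⁻¹, by simpa [pos_iff_ne_zero] using hne, inv_inv u⟩
  have hu : ∀ᵐ u ∂σ, C ≤ ∫⁻ b, H u b ∂μ := by
    filter_upwards [hatom, arcsineMeasure_ae_mem_Ioo M⁻¹ m⁻¹] with u hu0 hu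
    have hl := Set.Ioo_subset_Icc_self (inv_mem_Ioo hm hM hu)
    by_cases htop : ∫⁻ b, H u b ∂μ = ⊤
    · rw [htop]; exact le_top
    have hnn : 0 ≤ᵐ[μ] fun b => K - min (Real.log |1 - u⁻¹ / b|) K :=
      ae_of_all _ fun b => sub_nonneg.2 (min_le_right _ _)
    have hYm : Measurable fun b => min (Real.log |1 - u⁻¹ / b|) K := by fun_prop
    have hi : Integrable (fun b => K - min (Real.log |1 - u⁻¹ / b|) K) μ :=
      (lintegral_ofReal_ne_top_iff_integrable
        (hYm.const_sub K).aestronglyMeasurable hnn).1 htop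
    have hi' : Integrable (fun b => min (Real.log |1 - u⁻¹ / b|) K) μ := by
      refine ((integrable_const K).sub hi).congr (ae_of_all _ fun b => ?_)
      simp only [Pi.sub_apply, sub_sub_cancel]
    simp only [hH]
    rw [lintegral_ofReal_const_sub hi' (ae_of_all _ fun b => min_le_right _ _)]
    have := hμ _ hl hu0 hi'
    exact ENNReal.ofReal_le_ofReal (by linarith)
  have hswap : ∫⁻ u, ∫⁻ b, H u b ∂μ ∂σ = ∫⁻ b, ∫⁻ u, H u b ∂σ ∂μ :=
    lintegral_lintegral_swap hHm.aemeasurable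
  have hle : ∫⁻ b, ∫⁻ u, H u b ∂σ ∂μ ≤ C := by
    calc _ ≤ ∫⁻ _, C ∂μ := lintegral_mono hb
      _ = C := by simp
  have hge : C ≤ ∫⁻ u, ∫⁻ b, H u b ∂μ ∂σ := by
    calc C = ∫⁻ _, C ∂σ := by simp
      _ ≤ _ := lintegral_mono_ae hu
  have eb : (fun b => ∫⁻ u, H u b ∂σ) =ᵐ[μ] fun _ => C := by
    refine ae_eq_of_ae_le_of_lintegral_le (ae_of_all _ hb) (ne_top_of_le_ne_top hCtop hle)
      aemeasurable_const ?_
    rw [← hswap]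
    simpa using hge
  have eu : (fun _ => C) =ᵐ[σ] fun u => ∫⁻ b, H u b ∂μ := by
    refine ae_eq_of_ae_le_of_lintegral_le hu (by simpa using hCtop)
      hHm.lintegral_prod_right'.aemeasurable ?_
    rw [hswap]
    simpa using hle
  have hmem : ∀ᵐ b ∂μ, b ∈ Set.Icc m M := by
    filter_upwards [eb] with b hb
    exact (lintegral_logCap_sub_le hm hmM b).2 hb
  refine ⟨hmem, ?_⟩
  -- Passes from almost every `u` to almost every curvature `l = u⁻¹`; on the support of `μ` the
  -- truncation is inactive and drops out.
  have := ae_add_inv (ae_of_ae_arcsineMeasure eu) 0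
  filter_upwards [this] with l hl hlm
  have hl0 : 0 < l := hm.trans hlm.1
  have hlI : (0 + l⁻¹) ∈ Set.Ioo M⁻¹ m⁻¹ := by
    rw [zero_add]
    exact ⟨(inv_lt_inv₀ hM hl0).2 hlm.2, (inv_lt_inv₀ hl0 hm).2 hlm.1⟩
  rw [← hC, hl hl0.ne' hlI]
  refine lintegral_congr_ae ?_
  filter_upwards [hmem] with b hb
  simp only [hH, zero_add, inv_inv]
  rw [min_eq_left]
  rw [div_eq_mul_inv]
  exact log_abs_one_sub_mul_le_logCap hm (Set.Ioo_subset_Icc_self hlm)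
    (abs_inv_le_of_mem_Icc hm hb)

end Converse

/-! ### An equalizing measure is determined by its moments -/

section Uniqueness

variable {m M : ℝ} {μ ν : Measure ℝ}

theorem integrable_of_ae_mem_Icc_of_continuousOn [IsFiniteMeasure μ]
    (hμ : ∀ᵐ b ∂μ, b ∈ Set.Icc m M) {g : ℝ → ℝ} (hgm : Measurable g)
    (hg : ContinuousOn g (Set.Icc m M)) : Integrable g μ := by
  obtain ⟨C, hC⟩ := isCompact_Icc.exists_bound_of_continuousOn hg
  exact Integrable.of_bound hgm.aestronglyMeasurable C (hμ.mono fun b hb => hC b hb)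

theorem continuousOn_log_sub_sub_log (hm : 0 < m) {w : ℝ} (hw : w < m) :
    ContinuousOn (fun b => Real.log (b - w) - Real.log b) (Set.Icc m M) := by
  refine ContinuousOn.sub (ContinuousOn.log (by fun_prop) fun b hb => ?_)
    (ContinuousOn.log continuousOn_id fun b hb => ?_)
  · have := hb.1; linarith
  · exact (hm.trans_le hb.1).ne'

theorem log_abs_one_sub_add_inv_div {w b u : ℝ} (hb : 0 < b) (hbw : w < b) (hu : u ≠ 0)
    (hne : u ≠ (b - w)⁻¹) :
    Real.log |1 - (w + u⁻¹) / b| =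
      Real.log (b - w) - Real.log b + Real.log |1 - u⁻¹ * (b - w)⁻¹| := by
  have hbw' : 0 < b - w := sub_pos.2 hbw
  have h1 : 1 - u⁻¹ * (b - w)⁻¹ ≠ 0 := by
    rw [sub_ne_zero]
    intro h
    apply hne
    rw [← mul_inv, eq_comm, inv_eq_one] at h
    exact eq_inv_of_mul_eq_one_left h
  have e : 1 - (w + u⁻¹) / b = (b - w) / b * (1 - u⁻¹ * (b - w)⁻¹) := by
    have := hbw'.ne'
    field_simp
    ring
  rw [e, abs_mul, Real.log_mul (abs_ne_zero.2 (by positivity)) (abs_ne_zero.2 h1), Real.log_abs,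
    Real.log_div hbw'.ne' hb.ne']

/-- The logarithmic moments of an equalizing measure outside of `[m, M]` do not depend on the
measure. -/
theorem IsEqualizing.integral_log_sub (hm : 0 < m) (hmM : m < M) [IsProbabilityMeasure μ]
    (hμ : IsEqualizing m M μ) {w : ℝ} (hw : w < m) :
    ∫ b, (Real.log (b - w) - Real.log b) ∂μ =
      Real.log (acceleratedRate m M) - Real.log (acceleratedRate (M - w)⁻¹ (m - w)⁻¹) := by
  have hmw : 0 < m - w := sub_pos.2 hw
  have hMw : 0 < M - w := by linarith
  have hac : (M - w)⁻¹ < (m - w)⁻¹ := (inv_lt_inv₀ hMw hmw).2 (by linarith)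
  have := isProbabilityMeasure_arcsineMeasure hac
  -- The law of `u = (l - w)⁻¹`, so that `l = w + u⁻¹` runs through `(m, M)`. As `1 - l / b = (b -
  -- w) / b * (1 - u⁻¹ * (b - w)⁻¹)` and `(b - w)⁻¹` lies in the interval of `σ`, the average over
  -- `u` is `D b + r` for every `b ∈ [m, M]`.
  set σ := arcsineMeasure (M - w)⁻¹ (m - w)⁻¹ with hσ
  set r := Real.log (acceleratedRate (M - w)⁻¹ (m - w)⁻¹) with hr
  set D : ℝ → ℝ := fun b => Real.log (b - w) - Real.log b with hD
  have hDi : Integrable D μ := integrable_of_ae_mem_Icc_of_continuousOn hμ.1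
    (by fun_prop) (continuousOn_log_sub_sub_log hm hw)
  have hcurv : ∀ᵐ u ∂σ, u ≠ 0 ∧ w + u⁻¹ ∈ Set.Ioo m M := by
    filter_upwards [arcsineMeasure_ae_mem_Ioo (M - w)⁻¹ (m - w)⁻¹] with u hu
    have := inv_mem_Ioo hmw hMw hu
    exact ⟨((inv_pos.2 hMw).trans hu.1).ne', by linarith [this.1], by linarith [this.2]⟩
  have hu : ∀ᵐ u ∂σ, ∫⁻ b, ENNReal.ofReal (logCap m M - Real.log |1 - (w + u⁻¹) / b|) ∂μ =
      ENNReal.ofReal (logCap m M - Real.log (acceleratedRate m M)) := by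
    filter_upwards [hcurv, (arcsineMeasure_absolutelyContinuous _ _).ae_le (ae_add_inv hμ.2 w)]
      with u h1 h2
    exact h2 h1.1 h1.2
  have hb : ∀ᵐ b ∂μ, D b + r ≤ logCap m M ∧
      ∫⁻ u, ENNReal.ofReal (logCap m M - Real.log |1 - (w + u⁻¹) / b|) ∂σ =
        ENNReal.ofReal (logCap m M - (D b + r)) := by
    filter_upwards [hμ.1] with b hb
    have hb0 : 0 < b := hm.trans_le hb.1
    have hbw : w < b := hw.trans_le hb.1
    have hmem : (b - w)⁻¹ ∈ Set.Icc (M - w)⁻¹ (m - w)⁻¹ :=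
      (inv_mem_Icc_iff hmw hMw).2 ⟨by linarith [hb.1], by linarith [hb.2]⟩
    obtain ⟨i, -, hiff⟩ :=
      log_abs_one_sub_inv_mul_arcsineMeasure (inv_pos.2 hMw) hac (b - w)⁻¹
    have hae : (fun u => D b + Real.log |1 - u⁻¹ * (b - w)⁻¹|) =ᵐ[σ]
        fun u => Real.log |1 - (w + u⁻¹) / b| := by
      filter_upwards [hcurv, Measure.ae_ne σ (b - w)⁻¹] with u h1 h2
      exact (log_abs_one_sub_add_inv_div hb0 hbw h1.1 h2).symm
    have hi : Integrable (fun u => Real.log |1 - (w + u⁻¹) / b|) σ :=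
      ((integrable_const (D b)).add i).congr hae
    have hint : ∫ u, Real.log |1 - (w + u⁻¹) / b| ∂σ = D b + r := by
      rw [← integral_congr_ae hae, integral_add (integrable_const _) i, hiff.1 hmem]
      simp [hr]
    have hcap : ∀ᵐ u ∂σ, Real.log |1 - (w + u⁻¹) / b| ≤ logCap m M := by
      filter_upwards [hcurv] with u h1
      rw [div_eq_mul_inv]
      exact log_abs_one_sub_mul_le_logCap hm (Set.Ioo_subset_Icc_self h1.2)
        (abs_inv_le_of_mem_Icc hm hb)
    refine ⟨?_, ?_⟩
    · rw [← hint]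
      calc _ ≤ ∫ _, logCap m M ∂σ := integral_mono_ae hi (integrable_const _) hcap
        _ = logCap m M := by simp
    · rw [lintegral_ofReal_const_sub hi hcap, hint]
  have hmeas : Measurable (Function.uncurry fun u b : ℝ =>
      ENNReal.ofReal (logCap m M - Real.log |1 - (w + u⁻¹) / b|)) := by
    unfold Function.uncurry; fun_prop
  have hDr : Integrable (fun b => D b + r) μ := hDi.add (integrable_const r)
  -- Integrating over `b` first gives the equalized value, integrating over `u` first gives `D b +
  -- r`; comparing them yields `∫ D ∂μ`.
  have hswap := lintegral_lintegral_swap (μ := σ) (ν := μ) hmeas.aemeasurable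
  rw [lintegral_congr_ae hu, lintegral_congr_ae (hb.mono fun b h => h.2),
    lintegral_ofReal_const_sub hDr (hb.mono fun b h => h.1),
    lintegral_const, measure_univ, mul_one] at hswap
  rw [integral_add hDi (integrable_const r), integral_const, probReal_univ, one_smul] at hswap
  have h1 := log_acceleratedRate_neg hm hmM
  have h2 := logCap_pos hm hmM
  have hpos : 0 < logCap m M - Real.log (acceleratedRate m M) := by linarith
  have h3 : 0 < logCap m M - (∫ b, D b ∂μ + r) := by
    rw [← ENNReal.ofReal_pos, ← hswap, ENNReal.ofReal_pos]
    exact hpos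
  have := (ENNReal.ofReal_eq_ofReal_iff hpos.le h3.le).1 hswap
  linarith

/-- Keeps `b - w'` away from `0` for `w'` near `w`, which dominates the derivatives under the
integral sign. -/
theorem inv_sub_le_of_lt {w w' b : ℝ} (hw : w < m) (hw' : w' < (w + m) / 2) (hb : m ≤ b) :
    0 < b - w' ∧ (b - w')⁻¹ ≤ ((m - w) / 2)⁻¹ := by
  have h1 : 0 < (m - w) / 2 := by linarith
  have h2 : (m - w) / 2 ≤ b - w' := by linarith
  exact ⟨by linarith, inv_anti₀ h1 h2⟩

theorem hasDerivAt_integral_log_sub [IsFiniteMeasure μ] (hm : 0 < m)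
    (hμ : ∀ᵐ b ∂μ, b ∈ Set.Icc m M) {w : ℝ} (hw : w < m) :
    HasDerivAt (fun w => ∫ b, (Real.log (b - w) - Real.log b) ∂μ) (∫ b, -(b - w)⁻¹ ∂μ) w := by
  refine (hasDerivAt_integral_of_dominated_loc_of_deriv_le (s := Set.Iio ((w + m) / 2))
    (F' := fun w b => -(b - w)⁻¹) (bound := fun _ => ((m - w) / 2)⁻¹)
    (Iio_mem_nhds (by linarith)) (Eventually.of_forall fun w' => ?_) ?_ ?_ ?_
    (integrable_const _) ?_).2
  · exact Measurable.aestronglyMeasurable (by fun_prop)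
  · exact integrable_of_ae_mem_Icc_of_continuousOn hμ (by fun_prop)
      (continuousOn_log_sub_sub_log hm hw)
  · exact Measurable.aestronglyMeasurable (by fun_prop)
  · filter_upwards [hμ] with b hb w' hw'
    obtain ⟨h1, h2⟩ := inv_sub_le_of_lt hw hw' hb.1
    rwa [norm_neg, Real.norm_eq_abs, abs_of_pos (inv_pos.2 h1)]
  · filter_upwards [hμ] with b hb w' hw'
    obtain ⟨h1, -⟩ := inv_sub_le_of_lt hw hw' hb.1
    refine ((((hasDerivAt_id w').const_sub b).log h1.ne').sub_const _).congr_deriv ?_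
    simp [neg_div]

theorem hasDerivAt_integral_inv_sub_pow [IsFiniteMeasure μ]
    (hμ : ∀ᵐ b ∂μ, b ∈ Set.Icc m M) (k : ℕ) {w : ℝ} (hw : w < m) :
    HasDerivAt (fun w => ∫ b, (b - w)⁻¹ ^ k ∂μ) (∫ b, k * (b - w)⁻¹ ^ (k + 1) ∂μ) w := by
  have hbd : 0 < (m - w) / 2 := by linarith
  refine (hasDerivAt_integral_of_dominated_loc_of_deriv_le (s := Set.Iio ((w + m) / 2))
    (F' := fun w b => k * (b - w)⁻¹ ^ (k + 1)) (bound := fun _ => k * ((m - w) / 2)⁻¹ ^ (k + 1))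
    (Iio_mem_nhds (by linarith)) (Eventually.of_forall fun w' => ?_) ?_ ?_ ?_
    (integrable_const _) ?_).2
  · exact Measurable.aestronglyMeasurable (by fun_prop)
  · refine integrable_of_ae_mem_Icc_of_continuousOn hμ (by fun_prop) ?_
    exact (ContinuousOn.inv₀ (by fun_prop) fun b hb => by have := hb.1; linarith).pow k
  · exact Measurable.aestronglyMeasurable (by fun_prop)
  · filter_upwards [hμ] with b hb w' hw'
    obtain ⟨h1, h2⟩ := inv_sub_le_of_lt hw hw' hb.1
    have := inv_pos.2 h1
    rw [Real.norm_eq_abs, abs_of_nonneg (by positivity)]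
    gcongr
  · filter_upwards [hμ] with b hb w' hw'
    obtain ⟨h1, -⟩ := inv_sub_le_of_lt hw hw' hb.1
    refine ((((hasDerivAt_id w').const_sub b).inv h1.ne').pow k).congr_deriv ?_
    rcases k with _ | k
    · simp
    · simp only [id_eq, neg_neg, Nat.add_sub_cancel, Pi.inv_apply]
      rw [one_div, ← inv_pow]
      ring

/-- Differentiate the identity in `w` repeatedly: `log (b - w)` yields `-(b - w)⁻¹`, and the `k`-th
power of `(b - w)⁻¹` yields `k` times the next one. -/
theorem integral_inv_sub_pow_eq [IsProbabilityMeasure μ] [IsProbabilityMeasure ν] (hm : 0 < m)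
    (hμ : ∀ᵐ b ∂μ, b ∈ Set.Icc m M) (hν : ∀ᵐ b ∂ν, b ∈ Set.Icc m M)
    (h : ∀ w < m, ∫ b, (Real.log (b - w) - Real.log b) ∂μ =
      ∫ b, (Real.log (b - w) - Real.log b) ∂ν) (k : ℕ) :
    ∀ w < m, ∫ b, (b - w)⁻¹ ^ k ∂μ = ∫ b, (b - w)⁻¹ ^ k ∂ν := by
  have hev : ∀ {F G : ℝ → ℝ}, (∀ w < m, F w = G w) → ∀ w < m, F =ᶠ[𝓝 w] G := fun hFG w hw =>
    eventually_of_mem (Iio_mem_nhds hw) hFG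
  induction k with
  | zero => intro w _; simp
  | succ k ih =>
    intro w hw
    -- The zeroth power has derivative `0`, so the first moment has to come from the logarithm.
    rcases Nat.eq_zero_or_pos k with rfl | hk
    · have h1 := hasDerivAt_integral_log_sub hm hμ hw
      have h2 := (hasDerivAt_integral_log_sub hm hν hw).congr_of_eventuallyEq (hev h w hw)
      have := h1.unique h2
      simpa [integral_neg] using this
    · have h1 := hasDerivAt_integral_inv_sub_pow hμ k hw
      have h2 := (hasDerivAt_integral_inv_sub_pow hν k hw).congr_of_eventuallyEq (hev ih w hw)
      have := h1.unique h2
      rw [integral_const_mul, integral_const_mul] at this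
      exact mul_left_cancel₀ (by positivity) this

/-- The exponential series of `exp (i t / b)` may be integrated term by term, since `b⁻¹ ≤ m⁻¹`
dominates it by the series of `exp (|t| / m)`. -/
theorem hasSum_charFun_map_inv [IsProbabilityMeasure μ] (hm : 0 < m)
    (hμ : ∀ᵐ b ∂μ, b ∈ Set.Icc m M) (t : ℝ) :
    HasSum (fun k : ℕ => (t * Complex.I) ^ k / (k.factorial : ℂ) *
      ((∫ b, b⁻¹ ^ k ∂μ : ℝ) : ℂ)) (charFun (μ.map Inv.inv) t) := by
  have hnorm : ∀ k : ℕ, ∀ᵐ b ∂μ,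
      ‖(t * Complex.I) ^ k / (k.factorial : ℂ) * ((b⁻¹ ^ k : ℝ) : ℂ)‖ ≤
        (|t| * m⁻¹) ^ k / (k.factorial : ℝ) := by
    intro k
    filter_upwards [hμ] with b hb
    have hb0 : 0 < b := hm.trans_le hb.1
    rw [norm_mul, norm_div, norm_pow, norm_mul, Complex.norm_I, Complex.norm_real,
      Complex.norm_natCast, Complex.norm_real, Real.norm_eq_abs, mul_one, norm_pow,
      Real.norm_eq_abs, abs_of_pos (inv_pos.2 hb0), mul_pow, div_mul_eq_mul_div]
    have : b⁻¹ ≤ m⁻¹ := inv_anti₀ hm hb.1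
    have := inv_pos.2 hb0
    gcongr
  have hint : ∀ k : ℕ, Integrable (fun b : ℝ => (t * Complex.I) ^ k / (k.factorial : ℂ) *
      ((b⁻¹ ^ k : ℝ) : ℂ)) μ := fun k =>
    Integrable.of_bound (Measurable.aestronglyMeasurable (by fun_prop)) _ (hnorm k)
  have hsum := hasSum_integral_of_summable_integral_norm hint (by
    refine Summable.of_nonneg_of_le (fun k => integral_nonneg fun b => norm_nonneg _)
      (fun k => ?_) (Real.summable_pow_div_factorial (|t| * m⁻¹))
    calc _ ≤ ∫ _, (|t| * m⁻¹) ^ k / (k.factorial : ℝ) ∂μ :=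
          integral_mono_ae (hint k).norm (integrable_const _) (hnorm k)
      _ = _ := by simp)
  have hcoef : ∀ k : ℕ, ∫ b, (t * Complex.I) ^ k / (k.factorial : ℂ) * ((b⁻¹ ^ k : ℝ) : ℂ) ∂μ =
      (t * Complex.I) ^ k / (k.factorial : ℂ) * ((∫ b, b⁻¹ ^ k ∂μ : ℝ) : ℂ) := fun k => by
    rw [integral_const_mul, integral_complex_ofReal]
  have hchar : charFun (μ.map Inv.inv) t =
      ∫ b, ∑' k : ℕ, (t * Complex.I) ^ k / (k.factorial : ℂ) * ((b⁻¹ ^ k : ℝ) : ℂ) ∂μ := by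
    rw [charFun_apply_real, integral_map measurable_inv.aemeasurable
      (Measurable.aestronglyMeasurable (by fun_prop))]
    refine integral_congr_ae (ae_of_all _ fun b => ?_)
    have := (NormedSpace.expSeries_div_hasSum_exp (𝔸 := ℂ) ((t : ℂ) * (b⁻¹ : ℝ) * Complex.I)).tsum_eq
    simp only
    rw [Complex.exp_eq_exp_ℂ, ← this]
    refine tsum_congr fun k => ?_
    push_cast
    ring
  rw [hchar]
  simpa only [hcoef] using hsum

/-- The formula for the logarithmic moments involves only `m`, `M` and `w`. So the moments of `1 /
b` agree (take `w = 0 < m`), hence the characteristic functions of `1 / b`, and inversion is an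
involution. -/
theorem IsEqualizing.unique (hm : 0 < m) (hmM : m < M) [IsProbabilityMeasure μ]
    [IsProbabilityMeasure ν] (hμ : IsEqualizing m M μ) (hν : IsEqualizing m M ν) : μ = ν := by
  have hmom := fun k => integral_inv_sub_pow_eq hm hμ.1 hν.1 (fun w hw => by
    rw [hμ.integral_log_sub hm hmM hw, hν.integral_log_sub hm hmM hw]) k 0 hm
  simp only [sub_zero] at hmom
  have hinv : Measurable (Inv.inv : ℝ → ℝ) := measurable_inv
  have := Measure.isProbabilityMeasure_map (μ := μ) hinv.aemeasurable
  have := Measure.isProbabilityMeasure_map (μ := ν) hinv.aemeasurable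
  have hmap : μ.map Inv.inv = ν.map Inv.inv := by
    refine Measure.ext_of_charFun (funext fun t => ?_)
    have h1 := hasSum_charFun_map_inv hm hμ.1 t
    simp_rw [hmom] at h1
    exact h1.unique (hasSum_charFun_map_inv hm hν.1 t)
  have hid : (Inv.inv : ℝ → ℝ) ∘ Inv.inv = id := funext inv_inv
  have := congrArg (Measure.map Inv.inv) hmap
  rwa [Measure.map_map hinv hinv, Measure.map_map hinv hinv, hid, Measure.map_id,
    Measure.map_id] at this

end Uniqueness

/-! ### Conclusion -/

theorem eq_arcsineMeasure_of_asymptoticallyAtMost {d : ℕ} (hd : 0 < d) {m M : ℝ} (hm : 0 < m)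
    (hmM : m < M) {Ω : Type*} [MeasurableSpace Ω] (P : Measure Ω) [IsProbabilityMeasure P]
    {α : ℕ → Ω → ℝ} {μ : Measure ℝ} (hα : IsIIDInverseStepsizes P α μ)
    (h : ∀ (f : EuclideanSpace ℝ (Fin d) → ℝ) (x₀ xstar : EuclideanSpace ℝ (Fin d)),
        IsInstance m M f x₀ xstar →
          AsymptoticallyAtMost P
            (fun n ω => contractionFactor f (fun t => α t ω) x₀ xstar n)
            (acceleratedRate m M)) :
    μ = arcsineMeasure m M := by
  have hμ : IsProbabilityMeasure μ := by
    rw [← (hα.law 0).map_eq]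
    exact Measure.isProbabilityMeasure_map (hα.law 0).aemeasurable
  have := isProbabilityMeasure_arcsineMeasure hmM
  let x₀ : EuclideanSpace ℝ (Fin d) := EuclideanSpace.single ⟨0, hd⟩ 1
  have hx₀ : x₀ ≠ 0 := by
    rw [← norm_ne_zero_iff]
    simp [x₀]
  refine IsEqualizing.unique hm hmM ?_ (isEqualizing_arcsineMeasure hm hmM)
  refine isEqualizing_of_forall_integral_le hm hmM fun l hl hatom hi => ?_
  -- The minorant `Y` is the truncated logarithm, so no integrability of `log |1 - l / b|` itself is
  -- needed.
  exact integral_le_log_of_asymptoticallyAtMost hα (acceleratedRate_pos hm hmM) hx₀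
    (h _ _ _ (isInstance_half_mul_norm_sq hd hm hl hx₀)) hatom (by fun_prop) hi
    fun b => min_le_left _ _

/-- Let `d ≥ 1` and `0 < m < M`, and let `α` be random stepsizes whose inverses are i.i.d. with
law `μ`. If `μ` is the Arcsine distribution on `(m, M)`, then gradient descent on every
radially-separable, `m`-strongly convex, `M`-smooth `f`, from every initialization other than the
minimizer, has contraction factor converging to the accelerated rate, almost surely and in `L¹`.
Conversely, if the asymptotic contraction factor is at most the accelerated rate for all such
`f` and initializations, then `μ` is the Arcsine distribution. -/
theorem mainTheorem5 {d : ℕ} (hd : 0 < d) {m M : ℝ} (hm : 0 < m) (hmM : m < M)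
    {Ω : Type*} [MeasurableSpace Ω] (P : Measure Ω) [IsProbabilityMeasure P]
    (α : ℕ → Ω → ℝ) (μ : Measure ℝ) (hα : IsIIDInverseStepsizes P α μ) :
    (μ = arcsineMeasure m M →
      ∀ (f : EuclideanSpace ℝ (Fin d) → ℝ) (x₀ xstar : EuclideanSpace ℝ (Fin d)),
        IsInstance m M f x₀ xstar →
          ConvergesAlmostSurely P
            (fun n ω => contractionFactor f (fun t => α t ω) x₀ xstar n)
            (acceleratedRate m M) ∧
          ConvergesInL1 P
            (fun n ω => contractionFactor f (fun t => α t ω) x₀ xstar n)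
            (acceleratedRate m M)) ∧
    ((∀ (f : EuclideanSpace ℝ (Fin d) → ℝ) (x₀ xstar : EuclideanSpace ℝ (Fin d)),
        IsInstance m M f x₀ xstar →
          AsymptoticallyAtMost P
            (fun n ω => contractionFactor f (fun t => α t ω) x₀ xstar n)
            (acceleratedRate m M)) →
      μ = arcsineMeasure m M) := by
  refine ⟨?_, eq_arcsineMeasure_of_asymptoticallyAtMost hd hm hmM P hα⟩
  rintro rfl f x₀ xstar hI
  exact convergence_of_arcsine hm hmM hα hI
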